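/- Let $a,b,s\in\mathbb{R}$ satisfy $$\frac12-\frac1b=s,\qquad 3\Big(\frac1a-\frac12\Big)=\frac2s-4,\qquad 2<b<\infty,\qquad 1\le a<2.$$ Then there is a constant $C>0$, depending only on $a$, $b$, $s$, such that every $f\in H^2(\mathbb{R}^3)$ (complex-valued) satisfies $$\|f\|_{L^b(\mathbb{R}^3)}\le C\,\|\partial_3 f\|_{L^a(\mathbb{R}^3)}^{\,s}\;\|\nabla^2 f\|_{L^2(\mathbb{R}^3)}^{\,1-s},$$ where $\partial_3 f$ and $\nabla^2 f=(\partial_i\partial_j f)_{1\le i,j\le 3}$ are distributional derivatives (which are square integrable functions), and $\|\partial_3 f\|_{L^a}$ may be $+\infty$ (with the convention $\infty\cdot 0=0$ on the right-hand side). -/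

import Mathlib

open MeasureTheory TemperedDistribution
open scoped SchwartzMap LineDeriv ENNReal NNReal

noncomputable section

/-- The space `ℝ³` with its Euclidean structure; the coordinates `x₁, x₂, x₃` have indices
`0, 1, 2`. -/
abbrev R3 : Type := EuclideanSpace ℝ (Fin 3)

/-- The standard basis vectors of `ℝ³`. -/
def stdBasis (i : Fin 3) : R3 := EuclideanSpace.single i 1

/-- Membership of `f ∈ L²(ℝ³; ℂ)` in the Sobolev space `H²(ℝ³)`. -/
def MemH2 (f : Lp ℂ 2 (volume : Measure R3)) : Prop :=
  MemSobolev 2 2 (f : 𝓢'(R3, ℂ))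

open Classical in
/-- The square integrable function that represents the tempered distribution `u`, if there is one
(it is then unique, see `l2Repr_unique`), and `0` otherwise. -/
def l2Repr (u : 𝓢'(R3, ℂ)) : Lp ℂ 2 (volume : Measure R3) :=
  if h : ∃ g : Lp ℂ 2 (volume : Measure R3), u = (g : 𝓢'(R3, ℂ)) then h.choose else 0

/-- The distributional derivative `∂ᵢ f`, as a square integrable function. -/
def partialDeriv (i : Fin 3) (f : Lp ℂ 2 (volume : Measure R3)) :
    Lp ℂ 2 (volume : Measure R3) :=
  l2Repr (∂_{stdBasis i} (f : 𝓢'(R3, ℂ)))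

/-- The distributional derivative `∂ᵢ ∂ⱼ f`, as a square integrable function. -/
def partialDeriv₂ (i j : Fin 3) (f : Lp ℂ 2 (volume : Measure R3)) :
    Lp ℂ 2 (volume : Measure R3) :=
  l2Repr (∂_{stdBasis i} (∂_{stdBasis j} (f : 𝓢'(R3, ℂ))))

/-- The Hessian `∇² f = (∂ᵢ ∂ⱼ f)ᵢⱼ`, pointwise with the Euclidean (Frobenius) norm. -/
def hessian (f : Lp ℂ 2 (volume : Measure R3)) (x : R3) : EuclideanSpace ℂ (Fin 3 × Fin 3) :=
  WithLp.toLp 2 fun ij => partialDeriv₂ ij.1 ij.2 f x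

theorem l2Repr_unique (g : Lp ℂ 2 (volume : Measure R3)) : l2Repr (g : 𝓢'(R3, ℂ)) = g := by
  have h : ∃ g' : Lp ℂ 2 (volume : Measure R3), (g : 𝓢'(R3, ℂ)) = (g' : 𝓢'(R3, ℂ)) := ⟨g, rfl⟩
  have hc := h.choose_spec
  rw [l2Repr, dif_pos h]
  have hk := LinearMap.ker_eq_bot.mp
    (Lp.ker_toTemperedDistributionCLM_eq_bot (F := ℂ) (μ := (volume : Measure R3)) (p := 2))
  exact hk hc.symm

theorem coe_partialDeriv {f : Lp ℂ 2 (volume : Measure R3)} (hf : MemH2 f) (i : Fin 3) :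
    (partialDeriv i f : 𝓢'(R3, ℂ)) = ∂_{stdBasis i} (f : 𝓢'(R3, ℂ)) := by
  have h : MemSobolev 0 2 (∂_{stdBasis i} (f : 𝓢'(R3, ℂ))) := by
    refine MemSobolev.mono (s := 1) (by norm_num) ?_
    have := MemSobolev.lineDerivOp (m := stdBasis i) hf
    norm_num at this
    exact this
  obtain ⟨g, hg⟩ := memSobolev_zero_iff.mp h
  rw [partialDeriv, hg, l2Repr_unique]

theorem coe_partialDeriv₂ {f : Lp ℂ 2 (volume : Measure R3)} (hf : MemH2 f) (i j : Fin 3) :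
    (partialDeriv₂ i j f : 𝓢'(R3, ℂ)) =
      ∂_{stdBasis i} (∂_{stdBasis j} (f : 𝓢'(R3, ℂ))) := by
  have h : MemSobolev 0 2 (∂_{stdBasis i} (∂_{stdBasis j} (f : 𝓢'(R3, ℂ)))) := by
    have := MemSobolev.lineDerivOp (m := stdBasis i) (MemSobolev.lineDerivOp (m := stdBasis j) hf)
    norm_num at this
    exact this
  obtain ⟨g, hg⟩ := memSobolev_zero_iff.mp h
  rw [partialDeriv₂, hg, l2Repr_unique]

end

/-!
For `u` of class `C²` with compact support, the Gagliardo–Loomis–Whitney argument, run with a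
different power of `|u|` in each direction, bounds `‖u‖_b ^ 3` by a constant times
`‖∂₁u‖_r ‖∂₂u‖_r ‖∂₃u‖_a` whenever `2 / r + 1 / a = 1 + 3 / b`. For `i = 1, 2` the norm `‖∂ᵢu‖_r`
lies between `‖∂ᵢu‖_p ≲ (‖u‖_b ‖∂ᵢ²u‖₂) ^ (1 / 2)`, where `2 / p = 1 / b + 1 / 2`, and the Sobolev
bound `‖∂ᵢu‖₆ ≲ ‖∇²u‖₂`. The powers of `‖u‖_b` on the right are then absorbed on the left.

A function `f ∈ H²` is approximated by mollifying and cutting off. Since only `∂₃f ∈ L^a` is known,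
the error `∂₃χ · f` is estimated by `‖∂₃χ‖_q ‖f‖₂` with `1 / a = 1 / q + 1 / 2`, and the cutoffs `χ`
have to be stretched more strongly in `x₃` for this to vanish. When `‖∂₃f‖_a = ∞`, the right-hand
side is infinite unless `∇²f = 0`, and then `f = 0` because `‖f‖₆ ≲ (‖f‖₂ ‖∇²f‖₂) ^ (1 / 2)`.
-/

open Function Filter Topology
open scoped ContDiff Convolution

section Holder

variable {α F G : Type*} [MeasurableSpace α] {μ : Measure α} [NormedAddCommGroup F]
  [NormedAddCommGroup G]

theorem lintegral_enorm_rpow_eq (f : α → F) {p : ℝ} (hp : 0 < p) :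
    ∫⁻ x, ‖f x‖ₑ ^ p ∂μ = eLpNorm f (ENNReal.ofReal p) μ ^ p := by
  rw [eLpNorm_eq_eLpNorm' (by simpa using hp) (by simp), ENNReal.toReal_ofReal hp.le,
    lintegral_rpow_enorm_eq_rpow_eLpNorm' hp]

theorem lintegral_enorm_rpow_mul_enorm_rpow_le {f : α → F} {g : α → G}
    (hf : AEStronglyMeasurable f μ) (hg : AEStronglyMeasurable g μ)
    {p₁ p₂ q₁ q₂ : ℝ} (hp₁ : 0 < p₁) (hp₂ : 0 < p₂) (hq₁ : 0 ≤ q₁) (hq₂ : 0 ≤ q₂)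
    (hsum : q₁ / p₁ + q₂ / p₂ = 1) :
    ∫⁻ x, ‖f x‖ₑ ^ q₁ * ‖g x‖ₑ ^ q₂ ∂μ ≤
      eLpNorm f (ENNReal.ofReal p₁) μ ^ q₁ * eLpNorm g (ENNReal.ofReal p₂) μ ^ q₂ := by
  have h := ENNReal.lintegral_mul_norm_pow_le (μ := μ) (hf.enorm.pow_const p₁)
    (hg.enorm.pow_const p₂) (div_nonneg hq₁ hp₁.le) (div_nonneg hq₂ hp₂.le) hsum
  simpa only [← ENNReal.rpow_mul, lintegral_enorm_rpow_eq, hp₁, hp₂, mul_div_cancel₀ _ hp₁.ne',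
    mul_div_cancel₀ _ hp₂.ne'] using h

theorem lintegral_enorm_rpow_mul_mul_le {H : Type*} [NormedAddCommGroup H] {f : α → F} {g : α → G}
    {h : α → H} (hf : AEStronglyMeasurable f μ) (hg : AEStronglyMeasurable g μ)
    (hh : AEStronglyMeasurable h μ) {p q r m : ℝ} (hp : 0 < p) (hq : 0 < q)
    (hr : 0 < r) (hm : 0 ≤ m) (hsum : m / p + 1 / q + 1 / r = 1) :
    ∫⁻ x, ‖f x‖ₑ ^ m * ‖g x‖ₑ * ‖h x‖ₑ ∂μ ≤
      eLpNorm f (ENNReal.ofReal p) μ ^ m * eLpNorm g (ENNReal.ofReal q) μ *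
        eLpNorm h (ENNReal.ofReal r) μ := by
  have key := ENNReal.lintegral_prod_norm_pow_le (μ := μ) Finset.univ
    (f := ![fun x => ‖f x‖ₑ ^ p, fun x => ‖g x‖ₑ ^ q, fun x => ‖h x‖ₑ ^ r])
    (p := ![m / p, 1 / q, 1 / r])
    (by
      simpa [Fin.forall_fin_succ] using
        ⟨hf.enorm.pow_const _, hg.enorm.pow_const _, hh.enorm.pow_const _⟩)
    (by simpa [Fin.sum_univ_three] using hsum)
    (by simpa [Fin.forall_fin_succ] using ⟨by positivity, hq.le, hr.le⟩)
  simpa [Fin.prod_univ_three, ← ENNReal.rpow_mul, lintegral_enorm_rpow_eq, hp, hq, hr,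
    mul_div_cancel₀, hp.ne', hq.ne', hr.ne'] using key

theorem eLpNorm_le_rpow_mul_rpow {f : α → F} (hf : AEStronglyMeasurable f μ) {p q r θ : ℝ}
    (hp : 0 < p) (hq : 0 < q) (hr : 0 < r) (hθ₀ : 0 ≤ θ) (hθ₁ : θ ≤ 1)
    (h : θ / p + (1 - θ) / q = 1 / r) :
    eLpNorm f (ENNReal.ofReal r) μ ≤
      eLpNorm f (ENNReal.ofReal p) μ ^ θ * eLpNorm f (ENNReal.ofReal q) μ ^ (1 - θ) := by
  have := sub_nonneg.2 hθ₁
  rw [← ENNReal.rpow_le_rpow_iff hr, ← lintegral_enorm_rpow_eq f hr,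
    ENNReal.mul_rpow_of_nonneg _ _ hr.le, ← ENNReal.rpow_mul, ← ENNReal.rpow_mul]
  calc ∫⁻ x, ‖f x‖ₑ ^ r ∂μ = ∫⁻ x, ‖f x‖ₑ ^ (θ * r) * ‖f x‖ₑ ^ ((1 - θ) * r) ∂μ := by
        refine lintegral_congr fun x => ?_
        rw [← ENNReal.rpow_add_of_nonneg _ _ (by positivity) (by positivity)]
        congr 1; ring
    _ ≤ _ := by
        refine lintegral_enorm_rpow_mul_enorm_rpow_le hf hf hp hq (by positivity) (by positivity) ?_
        linear_combination r * h + mul_one_div_cancel hr.ne'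

end Holder

theorem rpow_le_of_rpow_add_le_mul {U K : ℝ≥0∞} (hU₀ : U ≠ 0) (hU : U ≠ ⊤) {x y : ℝ}
    (h : U ^ (x + y) ≤ U ^ x * K) : U ^ y ≤ K := by
  rw [ENNReal.rpow_add _ _ hU₀ hU] at h
  exact (ENNReal.mul_le_mul_iff_right (ENNReal.rpow_pos (pos_iff_ne_zero.2 hU₀) hU).ne'
    (ENNReal.rpow_ne_top_of_ne_zero hU₀ hU)).1 h

theorem rpow_sum_eq_prod_rpow {ι : Type*} (s : Finset ι) (x : ℝ≥0∞) {f : ι → ℝ}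
    (hf : ∀ i ∈ s, 0 ≤ f i) : x ^ (∑ i ∈ s, f i) = ∏ i ∈ s, x ^ f i := by
  classical
  induction s using Finset.induction with
  | empty => simp
  | insert i s hi ih =>
    rw [Finset.forall_mem_insert] at hf
    rw [Finset.sum_insert hi, Finset.prod_insert hi,
      ENNReal.rpow_add_of_nonneg _ _ hf.1 (Finset.sum_nonneg hf.2), ih hf.2]

theorem le_mul_prod_rpow_of_rpow_le {ι : Type*} [Fintype ι] [Nonempty ι] {U K : ℝ≥0∞}
    (hU : U ≠ ⊤) {c a : ι → ℝ≥0∞} {δ : ι → ℝ} (hδ : ∀ i, 0 ≤ δ i) {e : ℝ} (he : 0 < e)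
    (h : U ^ (∑ i, (1 + δ i) * e) ≤
      K ^ (Fintype.card ι * e) * ∏ i, (c i * (U ^ δ i * a i)) ^ e) :
    U ≤ K * ∏ i, (c i * a i) ^ (1 / (Fintype.card ι : ℝ)) := by
  rcases eq_or_ne U 0 with rfl | hU₀
  · exact zero_le
  have hn : (0 : ℝ) < Fintype.card ι := by exact_mod_cast Fintype.card_pos
  have hexp : ∑ i, (1 + δ i) * e = ∑ i, δ i * e + Fintype.card ι * e := by
    simp [add_mul, Finset.sum_add_distrib, add_comm]
  have hprod : ∏ i, (c i * (U ^ δ i * a i)) ^ e = U ^ (∑ i, δ i * e) * ∏ i, (c i * a i) ^ e := by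
    rw [rpow_sum_eq_prod_rpow _ _ fun i _ => mul_nonneg (hδ i) he.le, ← Finset.prod_mul_distrib]
    refine Finset.prod_congr rfl fun i _ => ?_
    rw [mul_left_comm, ENNReal.mul_rpow_of_nonneg _ _ he.le, ENNReal.rpow_mul]
  rw [hprod, mul_left_comm, hexp] at h
  have hne : 0 < Fintype.card ι * e := by positivity
  rw [← ENNReal.rpow_le_rpow_iff hne, ENNReal.mul_rpow_of_nonneg _ _ hne.le,
    ← ENNReal.prod_rpow_of_nonneg hne.le]
  simp only [← ENNReal.rpow_mul, ← mul_assoc, one_div_mul_cancel hn.ne', one_mul]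
  exact rpow_le_of_rpow_add_le_mul hU₀ hU h

section LoomisWhitney

variable {ι : Type*} [Fintype ι] [DecidableEq ι] {A : ι → Type*} [∀ i, MeasurableSpace (A i)]
  {μ : ∀ i, Measure (A i)} [∀ i, SigmaFinite (μ i)] {p : ℝ} {g : ι → (∀ i, A i) → ℝ≥0∞}

theorem lintegral_prod_lintegral_rpow_le_of_le (hp : Real.HolderConjugate (Fintype.card ι) p)
    (hg : ∀ i, Measurable (g i)) {I : ι → ℝ≥0∞} (hI₀ : ∀ i, I i ≠ 0) (hI : ∀ i, I i ≠ ⊤)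
    (hgI : ∀ i, ∫⁻ x, g i x ∂.pi μ ≤ I i) :
    ∫⁻ x, ∏ i, (∫⁻ t, g i (update x i t) ∂μ i) ^ (1 / (Fintype.card ι - 1 : ℝ)) ∂.pi μ ≤
      Fintype.card ι ^ p * ∏ i, I i ^ (1 / (Fintype.card ι - 1 : ℝ)) := by
  have he : 0 ≤ 1 / (Fintype.card ι - 1 : ℝ) := one_div_nonneg.2 (sub_nonneg.2 hp.lt.le)
  set e := 1 / (Fintype.card ι - 1 : ℝ)
  set G : (∀ i, A i) → ℝ≥0∞ := fun x => ∑ i, (I i)⁻¹ * g i x with hG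
  have hGm : Measurable G := by fun_prop
  have hGI : ∫⁻ x, G x ∂.pi μ ≤ Fintype.card ι := by
    rw [hG, lintegral_finsetSum _ (by fun_prop)]
    calc ∑ i, ∫⁻ x, (I i)⁻¹ * g i x ∂.pi μ = ∑ i, (I i)⁻¹ * ∫⁻ x, g i x ∂.pi μ := by
          simp only [lintegral_const_mul _ (hg _)]
      _ ≤ ∑ i, (I i)⁻¹ * I i := by gcongr with i; exact hgI i
      _ = Fintype.card ι := by simp [ENNReal.inv_mul_cancel, hI₀, hI]
  have hgG (i x) : g i x ≤ I i * G x :=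
    calc g i x = I i * ((I i)⁻¹ * g i x) := by
          rw [← mul_assoc, ENNReal.mul_inv_cancel (hI₀ i) (hI i), one_mul]
      _ ≤ I i * G x := by
          gcongr
          exact Finset.single_le_sum (f := fun i => (I i)⁻¹ * g i x) (by simp) (Finset.mem_univ i)
  calc ∫⁻ x, ∏ i, (∫⁻ t, g i (update x i t) ∂μ i) ^ e ∂.pi μ
      ≤ ∫⁻ x, ∏ i, (I i * ∫⁻ t, G (update x i t) ∂μ i) ^ e ∂.pi μ := by
        gcongr with x i
        rw [← lintegral_const_mul' _ _ (hI i)]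
        exact lintegral_mono fun t => hgG i _
    _ = (∏ i, I i ^ e) * ∫⁻ x, ∏ i, (∫⁻ t, G (update x i t) ∂μ i) ^ e ∂.pi μ := by
        simp only [ENNReal.mul_rpow_of_nonneg _ _ he, Finset.prod_mul_distrib]
        exact lintegral_const_mul' _ _
          (ENNReal.prod_ne_top fun i _ => ENNReal.rpow_ne_top_of_nonneg he (hI i))
    _ ≤ (∏ i, I i ^ e) * (Fintype.card ι : ℝ≥0∞) ^ p := by
        gcongr
        exact (lintegral_prod_lintegral_pow_le μ hp hGm).trans
          (ENNReal.rpow_le_rpow hGI hp.symm.nonneg)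
    _ = _ := mul_comm _ _

theorem lintegral_prod_lintegral_rpow_le (hp : Real.HolderConjugate (Fintype.card ι) p)
    (hg : ∀ i, Measurable (g i)) (hfin : ∀ i, ∫⁻ x, g i x ∂.pi μ ≠ ⊤) :
    ∫⁻ x, ∏ i, (∫⁻ t, g i (update x i t) ∂μ i) ^ (1 / (Fintype.card ι - 1 : ℝ)) ∂.pi μ ≤
      Fintype.card ι ^ p * ∏ i, (∫⁻ x, g i x ∂.pi μ) ^ (1 / (Fintype.card ι - 1 : ℝ)) := by
  have he : 0 ≤ 1 / (Fintype.card ι - 1 : ℝ) := one_div_nonneg.2 (sub_nonneg.2 hp.lt.le)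
  set e := 1 / (Fintype.card ι - 1 : ℝ)
  have hlim : Tendsto (fun ε : ℝ≥0 => (Fintype.card ι : ℝ≥0∞) ^ p *
      ∏ i, ((∫⁻ x, g i x ∂.pi μ) + ε) ^ e) (𝓝[>] 0)
      (𝓝 (Fintype.card ι ^ p * ∏ i, (∫⁻ x, g i x ∂.pi μ) ^ e)) := by
    refine ENNReal.Tendsto.const_mul (ENNReal.tendsto_finsetProd_of_ne_top _ (fun i _ => ?_)
      fun i _ => ENNReal.rpow_ne_top_of_nonneg he (hfin i))
      (Or.inr (ENNReal.rpow_ne_top_of_nonneg hp.symm.nonneg (ENNReal.natCast_ne_top _)))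
    have h : Continuous fun ε : ℝ≥0 => ((∫⁻ x, g i x ∂.pi μ) + ε) ^ e :=
      ENNReal.continuous_rpow_const.comp (by fun_prop)
    simpa using (h.tendsto 0).mono_left nhdsWithin_le_nhds
  refine ge_of_tendsto hlim ?_
  filter_upwards [self_mem_nhdsWithin] with ε (hε : 0 < ε)
  exact lintegral_prod_lintegral_rpow_le_of_le hp hg (by simp [hε.ne']) (by simp [hfin])
    fun i => le_self_add

end LoomisWhitney

section DirDeriv

variable {E F : Type*} [NormedAddCommGroup E] [NormedSpace ℝ E] [NormedAddCommGroup F]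
  [NormedSpace ℝ F]

/-- The classical derivative `∂ᵥ u` of `u` in the direction `v`, as an operator on functions. -/
noncomputable def dirDeriv (v : E) (u : E → F) (x : E) : F := fderiv ℝ u x v

theorem contDiff_dirDeriv {u : E → F} {m n : ℕ∞ω} (hu : ContDiff ℝ n u) (hmn : m + 1 ≤ n)
    (v : E) : ContDiff ℝ m (dirDeriv v u) :=
  (hu.fderiv_right hmn).clm_apply contDiff_const

theorem continuous_dirDeriv {u : E → F} (hu : ContDiff ℝ 1 u) (v : E) :
    Continuous (dirDeriv v u) :=
  (hu.continuous_fderiv one_ne_zero).clm_apply continuous_const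

theorem hasCompactSupport_dirDeriv {u : E → F} (hc : HasCompactSupport u) (v : E) :
    HasCompactSupport (dirDeriv v u) :=
  hc.fderiv_apply ℝ v

end DirDeriv

section Troisi

variable {ι F : Type*} [Fintype ι] [DecidableEq ι] [NormedAddCommGroup F] [InnerProductSpace ℝ F]

theorem enorm_rpow_le_lintegral_deriv {v : ℝ → F} (hv : ContDiff ℝ 1 v)
    (hc : HasCompactSupport v) {γ : ℝ} (hγ : 1 ≤ γ) (t : ℝ) :
    ‖v t‖ₑ ^ γ ≤ ∫⁻ τ, ENNReal.ofReal γ * (‖v τ‖ₑ ^ (γ - 1) * ‖deriv v τ‖ₑ) := by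
  rcases hγ.eq_or_lt with rfl | hγ'
  · simpa using (hc.enorm_le_lintegral_Ici_deriv hv t).trans
      (lintegral_mono' Measure.restrict_le_self le_rfl)
  have hγ₀ : 0 < γ := zero_lt_one.trans hγ'
  have hvγ : ContDiff ℝ 1 fun τ => ‖v τ‖ ^ γ := hv.norm_rpow hγ'
  have hcγ : HasCompactSupport fun τ => ‖v τ‖ ^ γ :=
    hc.comp_left (g := fun z => ‖z‖ ^ γ) (by simp [hγ₀.ne'])
  calc ‖v t‖ₑ ^ γ = ‖‖v t‖ ^ γ‖ₑ := by
        rw [Real.enorm_rpow_of_nonneg (norm_nonneg _) hγ₀.le, enorm_norm]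
    _ ≤ ∫⁻ τ, ‖deriv (fun τ => ‖v τ‖ ^ γ) τ‖ₑ :=
        (hcγ.enorm_le_lintegral_Ici_deriv hvγ t).trans
          (lintegral_mono' Measure.restrict_le_self le_rfl)
    _ ≤ _ := by
        refine lintegral_mono fun τ => ?_
        have h := enorm_fderiv_norm_rpow_le (hv.differentiable one_ne_zero) (x := τ)
          (p := γ.toNNReal) (by simpa using hγ')
        simp only [Real.coe_toNNReal γ hγ₀.le] at h
        simpa only [enorm, nnnorm, norm_deriv_eq_norm_fderiv, mul_assoc, ENNReal.ofReal] using h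

theorem enorm_rpow_le_lintegral_dirDeriv {u : EuclideanSpace ℝ ι → F} (hu : ContDiff ℝ 1 u)
    (hc : HasCompactSupport u) {γ : ℝ} (hγ : 1 ≤ γ) (i : ι) (y : ι → ℝ) :
    ‖u (WithLp.toLp 2 y)‖ₑ ^ γ ≤
      ∫⁻ t, ENNReal.ofReal γ * (‖u (WithLp.toLp 2 (update y i t))‖ₑ ^ (γ - 1) *
        ‖dirDeriv (EuclideanSpace.single i 1) u (WithLp.toLp 2 (update y i t))‖ₑ) := by
  let e := (PiLp.continuousLinearEquiv 2 ℝ (fun _ : ι => ℝ)).symm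
  have hline : ContDiff ℝ 1 fun t => (WithLp.toLp 2 (update y i t) : EuclideanSpace ℝ ι) :=
    e.contDiff.comp (by convert! contDiff_update 1 y i)
  have hemb : IsClosedEmbedding fun t => (WithLp.toLp 2 (update y i t) : EuclideanSpace ℝ ι) :=
    e.toHomeomorph.isClosedEmbedding.comp (isClosedEmbedding_update y i)
  have hd (t : ℝ) : deriv (u ∘ fun t => (WithLp.toLp 2 (update y i t) : EuclideanSpace ℝ ι)) t =
      dirDeriv (EuclideanSpace.single i 1) u (WithLp.toLp 2 (update y i t)) :=
    ((hu.differentiable one_ne_zero _).hasFDerivAt.comp_hasDerivAt t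
      (e.hasFDerivAt.comp_hasDerivAt t (hasDerivAt_update y i t))).deriv
  simpa [hd] using enorm_rpow_le_lintegral_deriv (hu.comp hline)
    (hc.comp_isClosedEmbedding hemb) hγ (y i)

theorem lintegral_rpow_mul_dirDeriv_ne_top {E : Type*} [NormedAddCommGroup E] [NormedSpace ℝ E]
    [MeasurableSpace E] [OpensMeasurableSpace E] {μ : Measure E} [IsFiniteMeasureOnCompacts μ]
    {u : E → F} (hu : ContDiff ℝ 1 u) (hc : HasCompactSupport u) {q : ℝ} (hq : 0 ≤ q) (v : E) :
    ∫⁻ x, ‖u x‖ₑ ^ q * ‖dirDeriv v u x‖ₑ ∂μ ≠ ⊤ := by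
  have hcont : Continuous fun x => ‖u x‖ ^ q * ‖dirDeriv v u x‖ :=
    (hu.continuous.norm.rpow_const fun _ => Or.inr hq).mul (continuous_dirDeriv hu v).norm
  have hcs : HasCompactSupport fun x => ‖u x‖ ^ q * ‖dirDeriv v u x‖ :=
    (hasCompactSupport_dirDeriv hc v).norm.mul_left
  simpa only [enorm_mul, Real.enorm_rpow_of_nonneg (norm_nonneg _) hq, enorm_norm] using
    (hasFiniteIntegral_iff_enorm.1
      (hcont.integrable_of_hasCompactSupport (μ := μ) hcs).hasFiniteIntegral).ne

theorem lintegral_enorm_rpow_le_prod_lintegral_dirDeriv {p : ℝ}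
    (hp : Real.HolderConjugate (Fintype.card ι) p) {u : EuclideanSpace ℝ ι → F}
    (hu : ContDiff ℝ 1 u) (hc : HasCompactSupport u) {γ : ι → ℝ} (hγ : ∀ i, 1 ≤ γ i) :
    ∫⁻ x, ‖u x‖ₑ ^ (∑ i, γ i * (1 / (Fintype.card ι - 1))) ≤
      Fintype.card ι ^ p * ∏ i, (ENNReal.ofReal (γ i) * ∫⁻ x, ‖u x‖ₑ ^ (γ i - 1) *
        ‖dirDeriv (EuclideanSpace.single i 1) u x‖ₑ) ^ (1 / (Fintype.card ι - 1 : ℝ)) := by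
  have hmp := PiLp.volume_preserving_toLp ι
  have he : 0 ≤ 1 / (Fintype.card ι - 1 : ℝ) := one_div_nonneg.2 (sub_nonneg.2 hp.lt.le)
  set e := 1 / (Fintype.card ι - 1 : ℝ)
  have hγ₀ (i) : 0 ≤ γ i := zero_le_one.trans (hγ i)
  let g (i : ι) (x : EuclideanSpace ℝ ι) : ℝ≥0∞ := ENNReal.ofReal (γ i) *
    (‖u x‖ₑ ^ (γ i - 1) * ‖dirDeriv (EuclideanSpace.single i 1) u x‖ₑ)
  have hgm (i) : Measurable (g i) := ((hu.continuous.enorm.measurable.pow_const _).mul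
    (continuous_dirDeriv hu _).enorm.measurable).const_mul _
  have hgI (i) : ∫⁻ y, g i (WithLp.toLp 2 y) = ENNReal.ofReal (γ i) *
      ∫⁻ x, ‖u x‖ₑ ^ (γ i - 1) * ‖dirDeriv (EuclideanSpace.single i 1) u x‖ₑ := by
    rw [hmp.lintegral_comp (hgm i), lintegral_const_mul' _ _ ENNReal.ofReal_ne_top]
  have hLW := lintegral_prod_lintegral_rpow_le (μ := fun _ : ι => (volume : Measure ℝ)) hp
    (fun i => (hgm i).comp hmp.measurable) fun i => by
      rw [← volume_pi]
      exact (hgI i).trans_ne (ENNReal.mul_ne_top ENNReal.ofReal_ne_top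
        (lintegral_rpow_mul_dirDeriv_ne_top hu hc (sub_nonneg.2 (hγ i)) _))
  simp only [← volume_pi, comp_apply, hgI] at hLW
  refine le_trans ?_ hLW
  rw [← hmp.lintegral_comp (hu.continuous.enorm.measurable.pow_const _)]
  refine lintegral_mono fun y => ?_
  rw [rpow_sum_eq_prod_rpow _ _ fun i _ => mul_nonneg (hγ₀ i) he]
  simp only [ENNReal.rpow_mul]
  gcongr with i
  exact enorm_rpow_le_lintegral_dirDeriv hu hc (hγ i) i y

theorem eLpNorm_rpow_le_prod_eLpNorm_dirDeriv {q : ℝ}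
    (hq : Real.HolderConjugate (Fintype.card ι) q) {u : EuclideanSpace ℝ ι → F}
    (hu : ContDiff ℝ 1 u) (hc : HasCompactSupport u) {p δ : ι → ℝ} (hp : ∀ i, 0 < p i)
    (hδ : ∀ i, 0 ≤ δ i) {β : ℝ} (hβ : 0 < β) (hδp : ∀ i, δ i / β + 1 / p i = 1)
    (hsum : ∑ i, (1 + δ i) * (1 / (Fintype.card ι - 1)) = β) :
    eLpNorm u (ENNReal.ofReal β) ^ β ≤ Fintype.card ι ^ q *
      ∏ i, (ENNReal.ofReal (1 + δ i) * (eLpNorm u (ENNReal.ofReal β) ^ δ i *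
        eLpNorm (dirDeriv (EuclideanSpace.single i 1) u) (ENNReal.ofReal (p i)))) ^
          (1 / (Fintype.card ι - 1 : ℝ)) := by
  have h := lintegral_enorm_rpow_le_prod_lintegral_dirDeriv hq hu hc
    fun i => le_add_of_nonneg_right (hδ i)
  rw [hsum, lintegral_enorm_rpow_eq u hβ] at h
  refine h.trans ?_
  gcongr with i
  · exact one_div_nonneg.2 (sub_nonneg.2 hq.lt.le)
  simpa using lintegral_enorm_rpow_mul_enorm_rpow_le (μ := volume)
    hu.continuous.aestronglyMeasurable
    (continuous_dirDeriv hu (EuclideanSpace.single i 1)).aestronglyMeasurable hβ (hp i) (hδ i)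
    zero_le_one (hδp i)

/-- **Troisi's inequality**. -/
theorem eLpNorm_le_prod_eLpNorm_dirDeriv [Nontrivial ι] {u : EuclideanSpace ℝ ι → F}
    (hu : ContDiff ℝ 1 u) (hc : HasCompactSupport u) {p : ι → ℝ} (hp : ∀ i, 1 ≤ p i) {β : ℝ}
    (hβ : 0 < β) (hsum : ∑ i, 1 / p i = 1 + Fintype.card ι / β) :
    eLpNorm u (ENNReal.ofReal β) ≤ Fintype.card ι * ∏ i, (ENNReal.ofReal (1 + β * (1 - 1 / p i)) *
      eLpNorm (dirDeriv (EuclideanSpace.single i 1) u) (ENNReal.ofReal (p i))) ^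
        (1 / (Fintype.card ι : ℝ)) := by
  have hn : (1 : ℝ) < Fintype.card ι := by exact_mod_cast Fintype.one_lt_card
  have hn₁ : 0 < (Fintype.card ι - 1 : ℝ) := sub_pos.2 hn
  have hconj : Real.HolderConjugate (Fintype.card ι)
      (Fintype.card ι * (1 / (Fintype.card ι - 1 : ℝ))) := by
    rw [mul_one_div]; exact .conjExponent hn
  have hp₀ (i) : 0 < p i := zero_lt_one.trans_le (hp i)
  have hδ (i) : 0 ≤ β * (1 - 1 / p i) :=
    mul_nonneg hβ.le (sub_nonneg.2 ((div_le_one (hp₀ i)).2 (hp i)))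
  have hδp (i) : β * (1 - 1 / p i) / β + 1 / p i = 1 := by
    rw [mul_div_cancel_left₀ _ hβ.ne', sub_add_cancel]
  have hexp : ∑ i, (1 + β * (1 - 1 / p i)) * (1 / (Fintype.card ι - 1)) = β := by
    simp only [← Finset.sum_mul, ← Finset.mul_sum, Finset.sum_sub_distrib, hsum,
      Finset.sum_add_distrib, Finset.sum_const, Finset.card_univ, nsmul_eq_mul]
    field
  refine le_mul_prod_rpow_of_rpow_le
    (hu.continuous.memLp_of_hasCompactSupport hc).eLpNorm_ne_top hδ (one_div_pos.2 hn₁) ?_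
  rw [hexp]
  exact eLpNorm_rpow_le_prod_eLpNorm_dirDeriv hconj hu hc hp₀ hδ hβ hδp hexp

end Troisi

section IntegrationByParts

variable {F : Type*} [NormedAddCommGroup F] [InnerProductSpace ℝ F]

theorem hasFDerivAt_norm_rpow_of_ne_zero {z : F} (hz : z ≠ 0) (q : ℝ) :
    HasFDerivAt (fun z : F => ‖z‖ ^ q) ((q * ‖z‖ ^ (q - 2)) • innerSL ℝ z) z := by
  apply HasStrictFDerivAt.hasFDerivAt
  convert! (hasStrictFDerivAt_norm_sq z).rpow_const (p := q / 2) (by simp [hz]) using 0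
  simp_rw [← Real.rpow_natCast_mul (norm_nonneg _), ← Nat.cast_smul_eq_nsmul ℝ, smul_smul]
  ring_nf

theorem hasFDerivAt_norm_rpow_smul_self (z : F) {q : ℝ} (hq : 0 ≤ q) :
    HasFDerivAt (fun z : F => ‖z‖ ^ q • z) (‖z‖ ^ q • ContinuousLinearMap.id ℝ F +
      ((q * ‖z‖ ^ (q - 2)) • innerSL ℝ z).smulRight z) z := by
  rcases eq_or_ne z 0 with rfl | hz
  · have hcont : Tendsto (fun z : F => ‖z‖ ^ q - ‖(0 : F)‖ ^ q) (𝓝 0) (𝓝 0) := by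
      simpa using ((continuous_norm.rpow_const fun _ => Or.inr hq).tendsto (0 : F)).sub_const
        (‖(0 : F)‖ ^ q)
    refine .of_isLittleO ?_
    simpa [sub_smul] using
      ((Asymptotics.isLittleO_one_iff ℝ).2 hcont).smul_isBigO (Asymptotics.isBigO_refl id (𝓝 0))
  · exact (hasFDerivAt_norm_rpow_of_ne_zero hz q).smul (hasFDerivAt_id z)

theorem norm_fderiv_norm_rpow_smul_self_le (z w : F) {q : ℝ} (hq : 0 ≤ q) :
    ‖‖z‖ ^ q • w + (q * ‖z‖ ^ (q - 2) * inner ℝ z w) • z‖ ≤ (q + 1) * (‖z‖ ^ q * ‖w‖) := by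
  have hpow : q * ‖z‖ ^ (q - 2) * (‖z‖ * ‖w‖) * ‖z‖ = q * (‖z‖ ^ q * ‖w‖) := by
    rcases hq.eq_or_lt with rfl | hq'
    · simp
    rcases (norm_nonneg z).eq_or_lt with hz | hz
    · simp [← hz, hq'.ne']
    · rw [Real.rpow_sub hz, Real.rpow_two]; field
  calc ‖‖z‖ ^ q • w + (q * ‖z‖ ^ (q - 2) * inner ℝ z w) • z‖
      ≤ ‖z‖ ^ q * ‖w‖ + q * ‖z‖ ^ (q - 2) * (‖z‖ * ‖w‖) * ‖z‖ := by
        refine (norm_add_le _ _).trans ?_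
        simp only [norm_smul, norm_mul, Real.norm_of_nonneg hq,
          Real.norm_of_nonneg (Real.rpow_nonneg (norm_nonneg z) _)]
        gcongr
        exact norm_inner_le_norm z w
    _ = _ := by rw [hpow]; ring

variable {E : Type*} [NormedAddCommGroup E] [NormedSpace ℝ E] [FiniteDimensional ℝ E]
  [MeasurableSpace E] [BorelSpace E] {μ : Measure E} [μ.IsAddHaarMeasure]

theorem exists_hasLineDerivAt_norm_rpow_smul_self {w : E → F} (hw : ContDiff ℝ 1 w) (v : E) {q : ℝ}
    (hq : 0 ≤ q) : ∃ D : E → F, StronglyMeasurable D ∧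
      (∀ x, HasLineDerivAt ℝ (fun x => ‖w x‖ ^ q • w x) (D x) x v) ∧
      ∀ x, ‖D x‖ ≤ (q + 1) * (‖w x‖ ^ q * ‖dirDeriv v w x‖) := by
  refine ⟨fun x => ‖w x‖ ^ q • dirDeriv v w x +
    (q * ‖w x‖ ^ (q - 2) * inner ℝ (w x) (dirDeriv v w x)) • w x, ?_, fun x => ?_,
    fun x => norm_fderiv_norm_rpow_smul_self_le (w x) (dirDeriv v w x) hq⟩
  · have := hw.continuous.stronglyMeasurable
    have := (continuous_dirDeriv hw v).stronglyMeasurable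
    have := (hw.continuous.norm.measurable.pow_const q).stronglyMeasurable
    have := (hw.continuous.norm.measurable.pow_const (q - 2)).stronglyMeasurable
    fun_prop
  · have h := (hasFDerivAt_norm_rpow_smul_self (w x) hq).comp x
      (hw.differentiable one_ne_zero x).hasFDerivAt
    simpa [dirDeriv, comp_def] using h.hasLineDerivAt v

/-- The integral `∫ ‖w‖ ^ (q + 2) = ∫ ⟪‖w‖ ^ q w, ∂ᵥu⟫` with `w = ∂ᵥu` is integrated by parts. -/
theorem integral_norm_dirDeriv_rpow_le {u : E → F} (hu : ContDiff ℝ 2 u)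
    (hc : HasCompactSupport u) (v : E) {q : ℝ} (hq : 0 ≤ q) :
    ∫ x, ‖dirDeriv v u x‖ ^ (q + 2) ∂μ ≤
      ∫ x, (q + 1) * (‖dirDeriv v u x‖ ^ q * ‖u x‖ * ‖dirDeriv v (dirDeriv v u) x‖) ∂μ := by
  set w := dirDeriv v u
  have hw : ContDiff ℝ 1 w := contDiff_dirDeriv hu one_add_one_eq_two.le v
  have hwq : Continuous fun x => ‖w x‖ ^ q := hw.continuous.norm.rpow_const fun _ => Or.inr hq
  obtain ⟨D, hDm, hD, hDw⟩ := exists_hasLineDerivAt_norm_rpow_smul_self hw v hq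
  have hDu (x : E) : ‖inner ℝ (D x) (u x)‖ ≤
      (q + 1) * (‖w x‖ ^ q * ‖u x‖ * ‖dirDeriv v w x‖) :=
    (norm_inner_le_norm _ _).trans
      ((mul_le_mul_of_nonneg_right (hDw x) (norm_nonneg _)).trans_eq (by ring))
  have hbound : Integrable (fun x => (q + 1) * (‖w x‖ ^ q * ‖u x‖ * ‖dirDeriv v w x‖)) μ :=
    (continuous_const.mul ((hwq.mul hu.continuous.norm).mul (continuous_dirDeriv hw v).norm)
      ).integrable_of_hasCompactSupport hc.norm.mul_left.mul_right.mul_left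
  have hparts := integral_bilinear_hasLineDerivAt_right_eq_neg_left_of_integrable (μ := μ)
    (B := innerSL ℝ) (f := fun x => ‖w x‖ ^ q • w x) (f' := D) (g := u) (g' := w) (v := v)
    (hbound.mono' (hDm.inner hu.continuous.stronglyMeasurable).aestronglyMeasurable
      (.of_forall hDu))
    (((hwq.smul hw.continuous).inner hw.continuous).integrable_of_hasCompactSupport
      ((hasCompactSupport_dirDeriv hc v).mono fun x hx h => hx (by simp [w, h])))
    (((hwq.smul hw.continuous).inner hu.continuous).integrable_of_hasCompactSupport
      (hc.mono fun x hx h => hx (by simp [h])))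
    (fun x _ => hD x)
    fun x _ => (hu.differentiable two_ne_zero x).hasFDerivAt.hasLineDerivAt v
  calc ∫ x, ‖w x‖ ^ (q + 2) ∂μ = ∫ x, inner ℝ (‖w x‖ ^ q • w x) (w x) ∂μ := by
        congr! 2 with x
        rw [real_inner_smul_left, real_inner_self_eq_norm_sq,
          Real.rpow_add_of_nonneg (norm_nonneg _) hq zero_le_two, Real.rpow_two]
    _ = -∫ x, inner ℝ (D x) (u x) ∂μ := hparts
    _ ≤ ∫ x, (q + 1) * (‖w x‖ ^ q * ‖u x‖ * ‖dirDeriv v w x‖) ∂μ :=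
        (neg_le_abs _).trans (norm_integral_le_of_norm_le hbound (.of_forall hDu))

theorem lintegral_enorm_dirDeriv_rpow_le {u : E → F} (hu : ContDiff ℝ 2 u)
    (hc : HasCompactSupport u) (v : E) {q : ℝ} (hq : 0 ≤ q) :
    ∫⁻ x, ‖dirDeriv v u x‖ₑ ^ (q + 2) ∂μ ≤ ENNReal.ofReal (q + 1) *
      ∫⁻ x, ‖dirDeriv v u x‖ₑ ^ q * ‖u x‖ₑ * ‖dirDeriv v (dirDeriv v u) x‖ₑ ∂μ := by
  have hq₂ : 0 ≤ q + 2 := by positivity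
  have hw : ContDiff ℝ 1 (dirDeriv v u) := contDiff_dirDeriv hu one_add_one_eq_two.le v
  have hw' := continuous_dirDeriv hw v
  have hleft : Integrable (fun x => ‖dirDeriv v u x‖ ^ (q + 2)) μ :=
    (hw.continuous.norm.rpow_const fun _ => Or.inr hq₂).integrable_of_hasCompactSupport
      ((hasCompactSupport_dirDeriv hc v).mono fun x hx h => hx (by
        simp [h, Real.zero_rpow (by positivity : q + 2 ≠ 0)]))
  have hright : Integrable (fun x => (q + 1) *
      (‖dirDeriv v u x‖ ^ q * ‖u x‖ * ‖dirDeriv v (dirDeriv v u) x‖)) μ :=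
    (continuous_const.mul (((hw.continuous.norm.rpow_const fun _ => Or.inr hq).mul
      hu.continuous.norm).mul hw'.norm)).integrable_of_hasCompactSupport
      hc.norm.mul_left.mul_right.mul_left
  have h := ENNReal.ofReal_le_ofReal (integral_norm_dirDeriv_rpow_le (μ := μ) hu hc v hq)
  rw [ofReal_integral_eq_lintegral_ofReal hleft (.of_forall fun x => by positivity),
    ofReal_integral_eq_lintegral_ofReal hright (.of_forall fun x => by positivity)] at h
  rw [← lintegral_const_mul' _ _ ENNReal.ofReal_ne_top]
  have hpow (x : E) {t : ℝ} (ht : 0 ≤ t) :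
      ENNReal.ofReal (‖dirDeriv v u x‖ ^ t) = ‖dirDeriv v u x‖ₑ ^ t := by
    rw [← ENNReal.ofReal_rpow_of_nonneg (norm_nonneg _) ht, ofReal_norm]
  have hmul (x : E) : ENNReal.ofReal
      ((q + 1) * (‖dirDeriv v u x‖ ^ q * ‖u x‖ * ‖dirDeriv v (dirDeriv v u) x‖)) =
      ENNReal.ofReal (q + 1) *
        (‖dirDeriv v u x‖ₑ ^ q * ‖u x‖ₑ * ‖dirDeriv v (dirDeriv v u) x‖ₑ) := by
    rw [ENNReal.ofReal_mul (by positivity), ENNReal.ofReal_mul (by positivity),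
      ENNReal.ofReal_mul (by positivity), hpow x hq, ofReal_norm, ofReal_norm]
  simpa only [hpow _ hq₂, hmul] using h

theorem eLpNorm_dirDeriv_le {u : E → F} (hu : ContDiff ℝ 2 u) (hc : HasCompactSupport u) (v : E)
    {b p r : ℝ} (hb : 0 < b) (hr : 0 < r) (hp : 2 ≤ p) (h : 2 / p = 1 / b + 1 / r) :
    eLpNorm (dirDeriv v u) (ENNReal.ofReal p) μ ≤
      (ENNReal.ofReal (p - 1) * eLpNorm u (ENNReal.ofReal b) μ *
        eLpNorm (dirDeriv v (dirDeriv v u)) (ENNReal.ofReal r) μ) ^ (1 / 2 : ℝ) := by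
  have hp₀ : 0 < p := zero_lt_two.trans_le hp
  obtain ⟨q, hq, rfl⟩ : ∃ q, 0 ≤ q ∧ p = q + 2 := ⟨p - 2, sub_nonneg.2 hp, by ring⟩
  have hw : ContDiff ℝ 1 (dirDeriv v u) := contDiff_dirDeriv hu one_add_one_eq_two.le v
  have hw' : Continuous (dirDeriv v (dirDeriv v u)) := continuous_dirDeriv hw v
  set W := eLpNorm (dirDeriv v u) (ENNReal.ofReal (q + 2)) μ with hW_def
  have hW : W ≠ ⊤ := (hw.continuous.memLp_of_hasCompactSupport
    (hasCompactSupport_dirDeriv hc v)).eLpNorm_ne_top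
  rcases eq_or_ne W 0 with hW₀ | hW₀
  · exact hW₀.trans_le zero_le
  have hparts : W ^ (q + 2) ≤ ENNReal.ofReal (q + 1) *
      ∫⁻ x, ‖dirDeriv v u x‖ₑ ^ q * ‖u x‖ₑ * ‖dirDeriv v (dirDeriv v u) x‖ₑ ∂μ := by
    rw [hW_def, ← lintegral_enorm_rpow_eq _ hp₀]
    exact lintegral_enorm_dirDeriv_rpow_le hu hc v hq
  have hHolder := lintegral_enorm_rpow_mul_mul_le (μ := μ) hw.continuous.aestronglyMeasurable
    hu.continuous.aestronglyMeasurable hw'.aestronglyMeasurable hp₀ hb hr hq (by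
      rw [add_assoc, ← h]; field)
  have hmain : W ^ (q + 2) ≤ W ^ q * (ENNReal.ofReal (q + 1) * eLpNorm u (ENNReal.ofReal b) μ *
      eLpNorm (dirDeriv v (dirDeriv v u)) (ENNReal.ofReal r) μ) := by
    refine hparts.trans ((mul_le_mul_right hHolder _).trans_eq ?_)
    ring
  have := rpow_le_of_rpow_add_le_mul hW₀ hW hmain
  rw [← ENNReal.rpow_le_rpow_iff zero_lt_two, ← ENNReal.rpow_mul,
    show (1 / 2 : ℝ) * 2 = 1 by norm_num, ENNReal.rpow_one]
  convert this using 2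
  ring_nf

end IntegrationByParts

section Smooth

variable {F : Type*} [NormedAddCommGroup F] [InnerProductSpace ℝ F] {u : R3 → F}

/-- The size of the classical Hessian of `u` in `L²`, as the largest `L²` norm of its entries. -/
noncomputable def hessianNorm (u : R3 → F) : ℝ≥0∞ :=
  ⨆ i, ⨆ j, eLpNorm (dirDeriv (stdBasis i) (dirDeriv (stdBasis j) u)) 2 volume

theorem eLpNorm_dirDeriv_dirDeriv_le_hessianNorm (u : R3 → F) (i j : Fin 3) :
    eLpNorm (dirDeriv (stdBasis i) (dirDeriv (stdBasis j) u)) 2 volume ≤ hessianNorm u :=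
  le_iSup₂_of_le i j le_rfl

theorem eLpNorm_six_le_of_eLpNorm_dirDeriv_le (hu : ContDiff ℝ 1 u) (hc : HasCompactSupport u)
    {K : ℝ≥0∞} (hK : ∀ i, eLpNorm (dirDeriv (stdBasis i) u) 2 volume ≤ K) :
    eLpNorm u 6 volume ≤ 12 * K := by
  have h := eLpNorm_le_prod_eLpNorm_dirDeriv hu hc (p := fun _ => 2) (β := 6)
    (fun _ => one_le_two) (by norm_num) (by simp; norm_num)
  have h4 : ENNReal.ofReal (1 + 6 * (1 - 1 / 2)) = 4 := by norm_num
  simp only [Fintype.card_fin, h4, ENNReal.ofReal_ofNat] at h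
  calc eLpNorm u 6 volume ≤ 3 * ∏ _i : Fin 3, (4 * K) ^ (1 / 3 : ℝ) := by
        refine h.trans ?_
        push_cast
        gcongr with i
        exact hK i
    _ = 3 * (4 * K) := by
        rw [ENNReal.prod_rpow_of_nonneg (by norm_num), Finset.prod_const, Finset.card_univ,
          Fintype.card_fin, ← ENNReal.rpow_natCast, ← ENNReal.rpow_mul]
        norm_num
    _ = 12 * K := by rw [← mul_assoc]; norm_num

theorem eLpNorm_dirDeriv_six_le_hessianNorm (hu : ContDiff ℝ 2 u) (hc : HasCompactSupport u)
    (j : Fin 3) : eLpNorm (dirDeriv (stdBasis j) u) 6 volume ≤ 12 * hessianNorm u :=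
  eLpNorm_six_le_of_eLpNorm_dirDeriv_le
    (contDiff_dirDeriv hu one_add_one_eq_two.le _) (hasCompactSupport_dirDeriv hc _)
    fun i => eLpNorm_dirDeriv_dirDeriv_le_hessianNorm u i j

theorem eLpNorm_dirDeriv_le_rpow_hessianNorm (hu : ContDiff ℝ 2 u) (hc : HasCompactSupport u)
    {b p : ℝ} (hb : 0 < b) (hp : 2 ≤ p) (h : 2 / p = 1 / b + 1 / 2) (i : Fin 3) :
    eLpNorm (dirDeriv (stdBasis i) u) (ENNReal.ofReal p) volume ≤
      (ENNReal.ofReal (p - 1) * eLpNorm u (ENNReal.ofReal b) volume * hessianNorm u) ^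
        (1 / 2 : ℝ) := by
  refine (eLpNorm_dirDeriv_le hu hc _ hb two_pos hp h).trans ?_
  rw [ENNReal.ofReal_ofNat]
  gcongr
  exact eLpNorm_dirDeriv_dirDeriv_le_hessianNorm u i i

theorem eLpNorm_six_le_rpow_hessianNorm (hu : ContDiff ℝ 2 u) (hc : HasCompactSupport u) :
    eLpNorm u 6 volume ≤ 12 * (eLpNorm u 2 volume * hessianNorm u) ^ (1 / 2 : ℝ) := by
  refine eLpNorm_six_le_of_eLpNorm_dirDeriv_le (hu.of_le one_le_two) hc fun i => ?_
  have h := eLpNorm_dirDeriv_le_rpow_hessianNorm hu hc two_pos le_rfl (by norm_num) i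
  rwa [show (2 : ℝ) - 1 = 1 by norm_num, ENNReal.ofReal_one, one_mul, ENNReal.ofReal_ofNat] at h

theorem eLpNorm_dirDeriv_le_of_interpolation (hu : ContDiff ℝ 2 u) (hc : HasCompactSupport u)
    {b p r θ : ℝ} (hb : 0 < b) (hp : 2 ≤ p) (hpb : 2 / p = 1 / b + 1 / 2) (hr : 0 < r)
    (hθ₀ : 0 ≤ θ) (hθ₁ : θ ≤ 1) (hpr : θ / p + (1 - θ) / 6 = 1 / r) (i : Fin 3) :
    eLpNorm (dirDeriv (stdBasis i) u) (ENNReal.ofReal r) volume ≤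
      ENNReal.ofReal (p - 1) ^ (θ / 2) * 12 ^ (1 - θ) *
        (eLpNorm u (ENNReal.ofReal b) volume ^ (θ / 2) * hessianNorm u ^ (1 - θ / 2)) := by
  have hθ₁' : 0 ≤ 1 - θ := sub_nonneg.2 hθ₁
  have hθ₂ : 0 ≤ θ / 2 := by positivity
  calc _ ≤ eLpNorm (dirDeriv (stdBasis i) u) (ENNReal.ofReal p) volume ^ θ *
        eLpNorm (dirDeriv (stdBasis i) u) 6 volume ^ (1 - θ) := by
        simpa only [ENNReal.ofReal_ofNat] using eLpNorm_le_rpow_mul_rpow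
          (continuous_dirDeriv (hu.of_le one_le_two) _).aestronglyMeasurable (by positivity)
          (by norm_num) hr hθ₀ hθ₁ hpr
    _ ≤ ((ENNReal.ofReal (p - 1) * eLpNorm u (ENNReal.ofReal b) volume * hessianNorm u) ^
        (1 / 2 : ℝ)) ^ θ * (12 * hessianNorm u) ^ (1 - θ) := by
        gcongr
        · exact eLpNorm_dirDeriv_le_rpow_hessianNorm hu hc hb hp hpb i
        · exact eLpNorm_dirDeriv_six_le_hessianNorm hu hc i
    _ = _ := by
        rw [show 1 - θ / 2 = θ / 2 + (1 - θ) by ring, ENNReal.rpow_add_of_nonneg _ _ hθ₂ hθ₁',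
          ← ENNReal.rpow_mul, one_div_mul_eq_div, ENNReal.mul_rpow_of_nonneg _ _ hθ₂,
          ENNReal.mul_rpow_of_nonneg _ _ hθ₂, ENNReal.mul_rpow_of_nonneg _ _ hθ₁']
        ring

theorem eLpNorm_rpow_three_le_prod_eLpNorm_dirDeriv (hu : ContDiff ℝ 1 u)
    (hc : HasCompactSupport u) {a b r : ℝ} (ha : 1 ≤ a) (hr : 1 ≤ r) (hb : 0 < b)
    (hsum : 2 / r + 1 / a = 1 + 3 / b) {K : ℝ≥0∞}
    (hK : ∀ i, eLpNorm (dirDeriv (stdBasis i) u) (ENNReal.ofReal r) volume ≤ K) :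
    eLpNorm u (ENNReal.ofReal b) volume ^ (3 : ℝ) ≤
      27 * ENNReal.ofReal (1 + b * (1 - 1 / r)) ^ 2 * ENNReal.ofReal (1 + b * (1 - 1 / a)) *
        (K ^ 2 * eLpNorm (dirDeriv (stdBasis 2) u) (ENNReal.ofReal a) volume) := by
  have h := eLpNorm_le_prod_eLpNorm_dirDeriv hu hc (p := ![r, r, a])
    (by simp [Fin.forall_fin_succ, ha, hr]) hb (by
      simp only [Fin.sum_univ_three, Matrix.cons_val, Fintype.card_fin]
      push_cast
      linear_combination hsum)
  rw [ENNReal.prod_rpow_of_nonneg (by positivity), Fin.prod_univ_three] at h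
  simp only [Matrix.cons_val, Fintype.card_fin] at h
  have h₃ := ENNReal.rpow_le_rpow h zero_le_three
  rw [ENNReal.mul_rpow_of_nonneg _ _ zero_le_three, ← ENNReal.rpow_mul,
    show ((3 : ℕ) : ℝ≥0∞) ^ (3 : ℝ) = 27 by norm_num,
    show 1 / ((3 : ℕ) : ℝ) * 3 = 1 by norm_num, ENNReal.rpow_one] at h₃
  calc _ ≤ _ := h₃
    _ ≤ 27 * (ENNReal.ofReal (1 + b * (1 - 1 / r)) * K * (ENNReal.ofReal (1 + b * (1 - 1 / r)) * K)
        * (ENNReal.ofReal (1 + b * (1 - 1 / a)) *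
          eLpNorm (dirDeriv (stdBasis 2) u) (ENNReal.ofReal a) volume)) := by
        gcongr
        exacts [hK 0, hK 1, le_rfl]
    _ = _ := by ring

theorem exists_interpolation_exponents {a b s : ℝ} (hs : 1 / 2 - 1 / b = s)
    (ha : 3 * (1 / a - 1 / 2) = 2 / s - 4) (hb : 2 < b) (ha₁ : 1 ≤ a) :
    ∃ θ p r : ℝ, 0 ≤ θ ∧ θ ≤ 1 ∧ 2 ≤ p ∧ 1 ≤ r ∧ θ + 1 / s = 3 ∧ 2 / p = 1 / b + 1 / 2 ∧
      θ / p + (1 - θ) / 6 = 1 / r ∧ 2 / r + 1 / a = 1 + 3 / b := by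
  have hs₀ : 0 < s := hs ▸ sub_pos.2 (one_div_lt_one_div_of_lt two_pos hb)
  have hs₁ : s < 1 / 2 := by linarith [one_div_pos.2 (two_pos.trans hb)]
  have hs₂ : 2 < 1 / s := by rwa [lt_one_div two_pos hs₀]
  have hs₃ : 1 / s ≤ 3 := by
    have := (div_le_one (zero_lt_one.trans_le ha₁)).2 ha₁
    linarith [show 2 / s = 2 * (1 / s) by ring]
  obtain ⟨d, hd⟩ : ∃ d, d = (3 - 1 / s) * ((1 - s) / 2) + (1 / s - 2) / 6 := ⟨_, rfl⟩
  have hd₂ : d = 5 / 3 - 3 / 2 * s - 1 / 3 * (1 / s) := by rw [hd]; field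
  refine ⟨3 - 1 / s, 2 / (1 - s), 1 / d, by linarith, by linarith, ?_, ?_, by ring, ?_, ?_, ?_⟩
  · rw [le_div_iff₀] <;> linarith
  · rw [le_one_div zero_lt_one] <;> nlinarith
  · rw [div_div_cancel₀ two_ne_zero]; linarith
  · rw [one_div_one_div, hd, div_div_eq_mul_div]; ring
  · rw [div_div_eq_mul_div, div_one, hd₂]
    linear_combination ha / 3 + 3 * hs

theorem le_rpow_mul_rpow_of_rpow_three_le {U A H c κ : ℝ≥0∞} (hU : U ≠ ⊤) {s θ : ℝ} (hs : 0 < s)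
    (hθs : θ + 1 / s = 3)
    (h : U ^ (3 : ℝ) ≤ c * ((κ * (U ^ (θ / 2) * H ^ (1 - θ / 2))) ^ 2 * A)) :
    U ≤ (c * κ ^ 2) ^ s * A ^ s * H ^ (1 - s) := by
  rcases eq_or_ne U 0 with rfl | hU₀
  · exact zero_le
  have hsq (x : ℝ≥0∞) (t : ℝ) : (x ^ (t / 2)) ^ 2 = x ^ t := by
    rw [← ENNReal.rpow_natCast, ← ENNReal.rpow_mul]; congr 1; push_cast; ring
  have hpow : U ^ (θ + 1 / s) ≤ U ^ θ * (c * κ ^ 2 * A * H ^ (2 - θ)) := by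
    rw [hθs, ← hsq U θ, ← hsq H (2 - θ), sub_div, div_self two_ne_zero]
    exact h.trans_eq (by ring)
  calc U = (U ^ (1 / s)) ^ s := by
        rw [← ENNReal.rpow_mul, one_div_mul_cancel hs.ne', ENNReal.rpow_one]
    _ ≤ (c * κ ^ 2 * A * H ^ (2 - θ)) ^ s :=
        ENNReal.rpow_le_rpow (rpow_le_of_rpow_add_le_mul hU₀ hU hpow) hs.le
    _ = _ := by
        rw [ENNReal.mul_rpow_of_nonneg _ _ hs.le, ENNReal.mul_rpow_of_nonneg _ _ hs.le,
          ← ENNReal.rpow_mul]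
        congr 2
        rw [show 2 - θ = 1 / s - 1 by linarith]
        field

theorem exists_eLpNorm_le_rpow_mul_hessianNorm_rpow {a b s : ℝ} (hs : 1 / 2 - 1 / b = s)
    (ha : 3 * (1 / a - 1 / 2) = 2 / s - 4) (hb : 2 < b) (ha₁ : 1 ≤ a) :
    ∃ C : ℝ≥0, ∀ u : R3 → F, ContDiff ℝ 2 u → HasCompactSupport u →
      eLpNorm u (ENNReal.ofReal b) volume ≤
        C * eLpNorm (dirDeriv (stdBasis 2) u) (ENNReal.ofReal a) volume ^ s *
          hessianNorm u ^ (1 - s) := by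
  have hb₀ : 0 < b := two_pos.trans hb
  have hs₀ : 0 < s := hs ▸ sub_pos.2 (one_div_lt_one_div_of_lt two_pos hb)
  obtain ⟨θ, p, r, hθ₀, hθ₁, hp, hr, hθs, hpb, hpr, hsum⟩ :=
    exists_interpolation_exponents hs ha hb ha₁
  obtain ⟨c, hc⟩ : ∃ c, c = 27 * ENNReal.ofReal (1 + b * (1 - 1 / r)) ^ 2 *
      ENNReal.ofReal (1 + b * (1 - 1 / a)) := ⟨_, rfl⟩
  obtain ⟨κ, hκ⟩ : ∃ κ, κ = ENNReal.ofReal (p - 1) ^ (θ / 2) * 12 ^ (1 - θ) := ⟨_, rfl⟩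
  have hfin : (c * κ ^ 2) ^ s ≠ ⊤ := by
    have : 0 ≤ 1 - θ := sub_nonneg.2 hθ₁
    have : 0 ≤ θ / 2 := by positivity
    rw [hc, hκ]
    finiteness
  refine ⟨((c * κ ^ 2) ^ s).toNNReal, fun u hu hcs => ?_⟩
  rw [ENNReal.coe_toNNReal hfin]
  refine le_rpow_mul_rpow_of_rpow_three_le
    (hu.continuous.memLp_of_hasCompactSupport hcs).eLpNorm_ne_top hs₀ hθs ?_
  rw [hc, hκ]
  exact eLpNorm_rpow_three_le_prod_eLpNorm_dirDeriv (hu.of_le one_le_two) hcs ha₁ hr hb₀ hsum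
    (eLpNorm_dirDeriv_le_of_interpolation hu hcs hb₀ hp hpb (zero_lt_one.trans_le hr) hθ₀ hθ₁ hpr)

end Smooth

section Mollification

variable {E F : Type*} [NormedAddCommGroup E] [NormedSpace ℝ E] [FiniteDimensional ℝ E]
  [MeasurableSpace E] [BorelSpace E] {μ : Measure E} [μ.IsAddHaarMeasure] [NormedAddCommGroup F]
  {φ : E → ℝ}

theorem lintegral_mul_rpow_le {α : Type*} [MeasurableSpace α] {ν : Measure α} {w h : α → ℝ≥0∞}
    (hw : AEMeasurable w ν) (hh : AEMeasurable h ν) (hw₁ : ∫⁻ x, w x ∂ν ≤ 1) {a : ℝ}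
    (ha : 1 ≤ a) : (∫⁻ x, w x * h x ∂ν) ^ a ≤ ∫⁻ x, w x * h x ^ a ∂ν := by
  have ha₀ : 0 < a := zero_lt_one.trans_le ha
  have ha₁ : 0 ≤ 1 - 1 / a := sub_nonneg.2 ((div_le_one ha₀).2 ha)
  have hHolder := ENNReal.lintegral_mul_norm_pow_le (μ := ν) (hw.mul (hh.pow_const a)) hw
    (one_div_nonneg.2 ha₀.le) ha₁ (by ring)
  have hsplit (x : α) : (w x * h x ^ a) ^ (1 / a) * w x ^ (1 - 1 / a) = w x * h x := by
    rw [ENNReal.mul_rpow_of_nonneg _ _ (by positivity), ← ENNReal.rpow_mul,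
      mul_one_div_cancel ha₀.ne', ENNReal.rpow_one, mul_right_comm,
      ← ENNReal.rpow_add_of_nonneg _ _ (by positivity) ha₁, add_sub_cancel, ENNReal.rpow_one]
  simp only [Pi.mul_apply, hsplit] at hHolder
  calc (∫⁻ x, w x * h x ∂ν) ^ a ≤ ((∫⁻ x, w x * h x ^ a ∂ν) ^ (1 / a) * 1) ^ a := by
        gcongr
        refine hHolder.trans ?_
        gcongr
        exact ENNReal.rpow_le_one hw₁ ha₁
    _ = _ := by
        rw [mul_one, ← ENNReal.rpow_mul, one_div_mul_cancel ha₀.ne', ENNReal.rpow_one]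

theorem eLpNorm_convolution_le [NormedSpace ℝ F] (hφ : Continuous φ)
    (hφ₁ : ∫⁻ x, ‖φ x‖ₑ ∂μ ≤ 1) {g : E → F} (hg : AEStronglyMeasurable g μ) {p : ℝ≥0∞}
    (hp : 1 ≤ p) (hp' : p ≠ ⊤) :
    eLpNorm (φ ⋆[ContinuousLinearMap.lsmul ℝ ℝ, μ] g) p μ ≤ eLpNorm g p μ := by
  obtain ⟨a, ha, rfl⟩ : ∃ a : ℝ, 1 ≤ a ∧ ENNReal.ofReal a = p :=
    ⟨p.toReal, by simpa using ENNReal.toReal_mono hp' hp, ENNReal.ofReal_toReal hp'⟩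
  have ha₀ : 0 < a := zero_lt_one.trans_le ha
  have hφ₂ : Continuous fun z : E × E => ‖φ (z.1 - z.2)‖ₑ := by fun_prop
  rw [← ENNReal.rpow_le_rpow_iff ha₀, ← lintegral_enorm_rpow_eq _ ha₀,
    ← lintegral_enorm_rpow_eq _ ha₀]
  calc ∫⁻ x, ‖(φ ⋆[ContinuousLinearMap.lsmul ℝ ℝ, μ] g) x‖ₑ ^ a ∂μ
      ≤ ∫⁻ x, ∫⁻ y, ‖φ (x - y)‖ₑ * ‖g y‖ₑ ^ a ∂μ ∂μ := by
        refine lintegral_mono fun x => ?_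
        refine le_trans ?_ (lintegral_mul_rpow_le
          (hφ₂.comp (Continuous.prodMk_right x)).aemeasurable hg.enorm ?_ ha)
        · gcongr
          rw [convolution_lsmul_swap]
          exact (enorm_integral_le_lintegral_enorm _).trans_eq (by simp only [enorm_smul]; rfl)
        · simpa only [comp_apply, lintegral_sub_left_eq_self (fun y => ‖φ y‖ₑ) x] using hφ₁
    _ = ∫⁻ y, ∫⁻ x, ‖φ (x - y)‖ₑ * ‖g y‖ₑ ^ a ∂μ ∂μ :=
        lintegral_lintegral_swap (hφ₂.aemeasurable.mul (hg.enorm.pow_const a).comp_snd)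
    _ = ∫⁻ y, (∫⁻ x, ‖φ x‖ₑ ∂μ) * ‖g y‖ₑ ^ a ∂μ := by
        refine lintegral_congr fun y => ?_
        rw [lintegral_mul_const _ (by fun_prop : Continuous fun x => ‖φ (x - y)‖ₑ).measurable,
          lintegral_sub_right_eq_self (fun x => ‖φ x‖ₑ) y]
    _ ≤ ∫⁻ y, ‖g y‖ₑ ^ a ∂μ := lintegral_mono fun y => mul_le_of_le_one_left' hφ₁

theorem dirDeriv_convolution [NormedSpace ℝ F] (hφ : ContDiff ℝ 1 φ) (hc : HasCompactSupport φ)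
    {g : E → F} (hg : LocallyIntegrable g μ) (v : E) :
    dirDeriv v (φ ⋆[ContinuousLinearMap.lsmul ℝ ℝ, μ] g) =
      dirDeriv v φ ⋆[ContinuousLinearMap.lsmul ℝ ℝ, μ] g := by
  ext x
  rw [← convolution_flip, dirDeriv, (hc.hasFDerivAt_convolution_right _ hg hφ x).fderiv,
    convolution_precompR_apply _ hg (hc.fderiv ℝ) (hφ.continuous_fderiv one_ne_zero),
    ← convolution_flip]
  rfl

theorem integral_smul_eq_neg_integral_dirDeriv_smul [NormedSpace ℂ F] [CompleteSpace F]
    {p : ℝ≥0∞} [Fact (1 ≤ p)] {g h : Lp F p μ} {v : E}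
    (hgh : (h : 𝓢'(E, F)) = ∂_{v} (g : 𝓢'(E, F))) {ψ : E → ℝ} (hψ : ContDiff ℝ ∞ ψ)
    (hc : HasCompactSupport ψ) :
    ∫ x, ψ x • h x ∂μ = -∫ x, dirDeriv v ψ x • g x ∂μ := by
  have hψ' : ContDiff ℝ ∞ fun x => (ψ x : ℂ) := Complex.ofRealCLM.contDiff.comp hψ
  have hc' : HasCompactSupport fun x => (ψ x : ℂ) := hc.comp_left Complex.ofReal_zero
  have hderiv (x : E) : (∂_{v} (hc'.toSchwartzMap hψ')) x = ((dirDeriv v ψ x : ℝ) : ℂ) := by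
    rw [SchwartzMap.lineDerivOp_apply_eq_fderiv]
    exact congrArg (fun T : E →L[ℝ] ℂ => T v) (Complex.ofRealCLM.hasFDerivAt.comp x
      (hψ.differentiable (by simp) x).hasFDerivAt).fderiv
  have key := congrArg (fun T : 𝓢'(E, F) => T (hc'.toSchwartzMap hψ')) hgh
  simp only [lineDerivOp_apply_apply, Lp.toTemperedDistribution_apply, neg_apply, hderiv,
    neg_smul, integral_neg] at key
  simp only [← Complex.coe_smul]
  exact key

theorem dirDeriv_convolution_Lp [NormedSpace ℂ F] [CompleteSpace F] (hφ : ContDiff ℝ ∞ φ)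
    (hc : HasCompactSupport φ) {p : ℝ≥0∞} [Fact (1 ≤ p)] {g h : Lp F p μ} {v : E}
    (hgh : (h : 𝓢'(E, F)) = ∂_{v} (g : 𝓢'(E, F))) :
    dirDeriv v (φ ⋆[ContinuousLinearMap.lsmul ℝ ℝ, μ] g) =
      φ ⋆[ContinuousLinearMap.lsmul ℝ ℝ, μ] h := by
  have hφ₁ : ContDiff ℝ 1 φ := hφ.of_le (by norm_cast)
  rw [dirDeriv_convolution hφ₁ hc ((Lp.memLp g).locallyIntegrable Fact.out)]
  ext x
  have hderiv (y : E) : dirDeriv v (fun y => φ (x - y)) y = -dirDeriv v φ (x - y) := by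
    have hφx := (hφ₁.differentiable one_ne_zero (x - y)).hasFDerivAt
    exact (congrArg (fun T : E →L[ℝ] ℝ => T v)
      (hφx.comp y ((hasFDerivAt_id y).const_sub x)).fderiv).trans (by simp [dirDeriv])
  have key := integral_smul_eq_neg_integral_dirDeriv_smul hgh (ψ := fun y => φ (x - y))
    (hφ.comp (contDiff_const.sub contDiff_id)) (hc.comp_homeomorph (Homeomorph.subLeft x))
  simp only [hderiv, neg_smul, integral_neg, neg_neg] at key
  rw [convolution_lsmul_swap, convolution_lsmul_swap, key]

theorem exists_mollifiers (μ : Measure E) [μ.IsAddHaarMeasure] [NormedSpace ℝ F]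
    [CompleteSpace F] :
    ∃ φ : ℕ → E → ℝ, (∀ n, ContDiff ℝ ∞ (φ n)) ∧ (∀ n, HasCompactSupport (φ n)) ∧
      (∀ n, ∫⁻ x, ‖φ n x‖ₑ ∂μ = 1) ∧ ∀ g : E → F, LocallyIntegrable g μ → ∀ᵐ x ∂μ,
        Tendsto (fun n => (φ n ⋆[ContinuousLinearMap.lsmul ℝ ℝ, μ] g) x) atTop (𝓝 (g x)) := by
  let bump (n : ℕ) : ContDiffBump (0 : E) :=
    { rIn := 1 / (n + 1), rOut := 2 / (n + 1), rIn_pos := by positivity,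
      rIn_lt_rOut := by gcongr; norm_num }
  have hrOut : Tendsto (fun n => (bump n).rOut) atTop (𝓝 0) := by
    simpa [bump, div_eq_mul_inv] using
      (tendsto_one_div_add_atTop_nhds_zero_nat (𝕜 := ℝ)).const_mul 2
  refine ⟨fun n => (bump n).normed μ, fun n => (bump n).contDiff_normed,
    fun n => (bump n).hasCompactSupport_normed, fun n => ?_, fun g hg => ?_⟩
  · simp only [Real.enorm_of_nonneg ((bump n).nonneg_normed _)]
    rw [← ofReal_integral_eq_lintegral_ofReal (bump n).integrable_normed
      (.of_forall (bump n).nonneg_normed), (bump n).integral_normed, ENNReal.ofReal_one]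
  · exact ContDiffBump.ae_convolution_tendsto_right_of_locallyIntegrable (K := 2) hrOut
      (.of_forall fun n => (by simp [bump, div_eq_mul_inv])) hg

end Mollification

section Leibniz

variable {E F : Type*} [NormedAddCommGroup E] [NormedSpace ℝ E] [NormedAddCommGroup F]
  [NormedSpace ℝ F] {χ : E → ℝ} {g h : E → F}

theorem dirDeriv_add (hg : Differentiable ℝ g) (hh : Differentiable ℝ h) (v : E) :
    dirDeriv v (g + h) = dirDeriv v g + dirDeriv v h := by
  ext x
  rw [dirDeriv, fderiv_add (hg x) (hh x)]
  rfl

theorem dirDeriv_const_smul (hg : Differentiable ℝ g) (c : ℝ) (v : E) :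
    dirDeriv v (c • g) = c • dirDeriv v g := by
  ext x
  rw [dirDeriv, fderiv_const_smul (hg x)]
  rfl

theorem dirDeriv_smul (hχ : Differentiable ℝ χ) (hg : Differentiable ℝ g) (v : E) :
    dirDeriv v (χ • g) = dirDeriv v χ • g + χ • dirDeriv v g := by
  ext x
  rw [dirDeriv, fderiv_smul (hχ x) (hg x)]
  exact add_comm _ _

variable [MeasurableSpace E] [BorelSpace E] [SecondCountableTopology E] {μ : Measure E}

theorem eLpNorm_dirDeriv_smul_le (hχ : ContDiff ℝ 1 χ) (hg : ContDiff ℝ 1 g) (v : E)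
    {p q r : ℝ≥0∞} [ENNReal.HolderTriple q p r] (hr : 1 ≤ r) :
    eLpNorm (dirDeriv v (χ • g)) r μ ≤
      eLpNorm (dirDeriv v χ) q μ * eLpNorm g p μ +
        eLpNorm χ ⊤ μ * eLpNorm (dirDeriv v g) r μ := by
  have hχv := continuous_dirDeriv hχ v
  have hgv := continuous_dirDeriv hg v
  rw [dirDeriv_smul (hχ.differentiable one_ne_zero) (hg.differentiable one_ne_zero)]
  exact (eLpNorm_add_le (hχv.smul hg.continuous).aestronglyMeasurable
    (hχ.continuous.smul hgv).aestronglyMeasurable hr).trans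
    (add_le_add
      (eLpNorm_smul_le_mul_eLpNorm hg.continuous.aestronglyMeasurable hχv.aestronglyMeasurable)
      (eLpNorm_smul_le_mul_eLpNorm hgv.aestronglyMeasurable
        hχ.continuous.aestronglyMeasurable))

theorem eLpNorm_dirDeriv_dirDeriv_smul_le (hχ : ContDiff ℝ 2 χ) (hg : ContDiff ℝ 2 g) (v w : E)
    {p : ℝ≥0∞} (hp : 1 ≤ p) :
    eLpNorm (dirDeriv v (dirDeriv w (χ • g))) p μ ≤
      (eLpNorm (dirDeriv v (dirDeriv w χ)) ⊤ μ * eLpNorm g p μ +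
        eLpNorm (dirDeriv w χ) ⊤ μ * eLpNorm (dirDeriv v g) p μ) +
      (eLpNorm (dirDeriv v χ) ⊤ μ * eLpNorm (dirDeriv w g) p μ +
        eLpNorm χ ⊤ μ * eLpNorm (dirDeriv v (dirDeriv w g)) p μ) := by
  have hχ₁ : ContDiff ℝ 1 χ := hχ.of_le one_le_two
  have hg₁ : ContDiff ℝ 1 g := hg.of_le one_le_two
  have hχw : ContDiff ℝ 1 (dirDeriv w χ) :=
    contDiff_dirDeriv hχ one_add_one_eq_two.le w
  have hgw : ContDiff ℝ 1 (dirDeriv w g) :=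
    contDiff_dirDeriv hg one_add_one_eq_two.le w
  rw [dirDeriv_smul (hχ₁.differentiable one_ne_zero) (hg₁.differentiable one_ne_zero),
    dirDeriv_add ((hχw.smul hg₁).differentiable one_ne_zero)
      ((hχ₁.smul hgw).differentiable one_ne_zero)]
  exact (eLpNorm_add_le (continuous_dirDeriv (hχw.smul hg₁) v).aestronglyMeasurable
    (continuous_dirDeriv (hχ₁.smul hgw) v).aestronglyMeasurable hp).trans
    (add_le_add (eLpNorm_dirDeriv_smul_le hχw hg₁ v hp) (eLpNorm_dirDeriv_smul_le hχ₁ hgw v hp))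

end Leibniz

section Scaling

variable {E F : Type*} [NormedAddCommGroup E] [NormedSpace ℝ E] [NormedAddCommGroup F]

theorem dirDeriv_comp_of_apply_eq_smul [NormedSpace ℝ F] {u : E → F} (hu : Differentiable ℝ u)
    {L : E →L[ℝ] E} {v : E} {c : ℝ} (hv : L v = c • v) :
    dirDeriv v (u ∘ L) = c • (dirDeriv v u ∘ L) := by
  ext x
  rw [dirDeriv, fderiv_comp x (hu _) L.differentiableAt, L.fderiv]
  simp [hv, dirDeriv]

theorem eLpNorm_comp_continuousLinearMap [FiniteDimensional ℝ E] [MeasurableSpace E]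
    [BorelSpace E] {μ : Measure E} [μ.IsAddHaarMeasure] {L : E →L[ℝ] E} (hL : L.det ≠ 0)
    {u : E → F} (hu : AEStronglyMeasurable u μ) (p : ℝ≥0∞) :
    eLpNorm (u ∘ L) p μ = ENNReal.ofReal |L.det⁻¹| ^ (1 / p).toReal * eLpNorm u p μ := by
  have hmap : Measure.map L μ = ENNReal.ofReal |L.det⁻¹| • μ :=
    Measure.map_linearMap_addHaar_eq_smul_addHaar μ hL
  have hc : ENNReal.ofReal |L.det⁻¹| ≠ 0 := by simpa using hL
  rw [← eLpNorm_map_measure (hmap ▸ hu.smul_measure _) L.continuous.aemeasurable, hmap,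
    eLpNorm_smul_measure_of_ne_zero hc, smul_eq_mul]

end Scaling

section Cutoff

/-- The exponents of the anisotropic scaling used for the cutoff functions. The stretching is
stronger in the direction `x₃`: for isotropic cutoffs `χ` at scale `R` one has
`‖∂₃ χ‖_q ~ R ^ (3 / q - 1)`, which does not tend to `0` if `q ≤ 3`. -/
def scalingExponent : Fin 3 → ℕ := ![1, 1, 3]

/-- The diagonal map `x ↦ (ε x₁, ε x₂, ε³ x₃)`. -/
noncomputable def anisotropicScaling (ε : ℝ) : R3 →L[ℝ] R3 :=
  LinearMap.toContinuousLinearMap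
    (Matrix.toEuclideanLin (Matrix.diagonal fun i => ε ^ scalingExponent i))

theorem scalingExponent_pos (i : Fin 3) : 0 < scalingExponent i := by
  fin_cases i <;> simp [scalingExponent]

theorem anisotropicScaling_apply (ε : ℝ) (x : R3) (i : Fin 3) :
    anisotropicScaling ε x i = ε ^ scalingExponent i * x i := by
  simp [anisotropicScaling, Matrix.toLpLin_apply, Matrix.mulVec_diagonal]

theorem anisotropicScaling_stdBasis (ε : ℝ) (i : Fin 3) :
    anisotropicScaling ε (stdBasis i) = ε ^ scalingExponent i • stdBasis i := by
  ext j
  rw [anisotropicScaling_apply]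
  by_cases h : j = i <;> simp [stdBasis, h]

theorem det_anisotropicScaling (ε : ℝ) : (anisotropicScaling ε).det = ε ^ 5 := by
  rw [anisotropicScaling, ContinuousLinearMap.det, LinearMap.coe_toContinuousLinearMap,
    LinearMap.det_toLpLin, Matrix.det_diagonal, Fin.prod_univ_three]
  simp only [scalingExponent, Matrix.cons_val]
  ring

theorem isClosedEmbedding_anisotropicScaling {ε : ℝ} (hε : ε ≠ 0) :
    IsClosedEmbedding (anisotropicScaling ε) := by
  refine LinearMap.isClosedEmbedding_of_injective (LinearMap.ker_eq_bot_of_injective ?_)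
  intro x y hxy
  ext i
  simpa [anisotropicScaling_apply, hε] using congrArg (fun z : R3 => z i) hxy

theorem tendsto_anisotropicScaling_zero (x : R3) :
    Tendsto (fun ε => anisotropicScaling ε x) (𝓝[>] 0) (𝓝 0) := by
  refine tendsto_nhdsWithin_of_tendsto_nhds ?_
  have h : Tendsto (fun ε => WithLp.ofLp (anisotropicScaling ε x)) (𝓝 0) (𝓝 0) := by
    refine tendsto_pi_nhds.2 fun i => ?_
    have hi : Continuous fun ε : ℝ => ε ^ scalingExponent i * x i := by fun_prop
    simpa [anisotropicScaling_apply, (scalingExponent_pos i).ne'] using hi.tendsto 0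
  exact ((PiLp.continuousLinearEquiv 2 ℝ (fun _ : Fin 3 => ℝ)).symm.continuous.tendsto 0).comp h

theorem tendsto_eLpNorm_pow_smul_comp_anisotropicScaling {g : R3 → ℝ} (hg : Continuous g)
    (hc : HasCompactSupport g) {k : ℕ} {p : ℝ≥0∞} (hk : 5 * (1 / p).toReal < k) :
    Tendsto (fun ε : ℝ => eLpNorm (ε ^ k • (g ∘ anisotropicScaling ε)) p volume)
      (𝓝[>] 0) (𝓝 0) := by
  have hlim : Tendsto (fun ε : ℝ =>
      ENNReal.ofReal (ε ^ (k - 5 * (1 / p).toReal)) * eLpNorm g p volume) (𝓝[>] 0) (𝓝 0) := by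
    have hpow := (Real.continuousAt_rpow_const 0 _ (.inr (sub_pos.2 hk).le)).tendsto
    rw [Real.zero_rpow (sub_pos.2 hk).ne'] at hpow
    simpa using ENNReal.Tendsto.mul_const
      (ENNReal.tendsto_ofReal (tendsto_nhdsWithin_of_tendsto_nhds hpow))
      (.inr (hg.memLp_of_hasCompactSupport hc).eLpNorm_ne_top)
  refine hlim.congr' ?_
  filter_upwards [self_mem_nhdsWithin] with ε hε
  have hε : 0 < ε := hε
  rw [eLpNorm_const_smul, eLpNorm_comp_continuousLinearMap
    (by rw [det_anisotropicScaling]; positivity) hg.aestronglyMeasurable, det_anisotropicScaling,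
    ← mul_assoc, Real.enorm_of_nonneg (by positivity), abs_of_pos (by positivity),
    ENNReal.ofReal_rpow_of_pos (by positivity), ← ENNReal.ofReal_mul (by positivity)]
  congr 2
  rw [Real.inv_rpow (by positivity), ← Real.rpow_natCast, ← Real.rpow_natCast,
    ← Real.rpow_mul hε.le, Real.rpow_sub hε, div_eq_mul_inv]
  norm_num

variable (η : ContDiffBump (0 : R3))

/-- A bump function stretched anisotropically, by the factors `ε⁻¹`, `ε⁻¹`, `ε⁻³`; it plays
the role of a cutoff function that converges to `1` as `ε → 0`. -/
noncomputable def anisotropicCutoff (ε : ℝ) : R3 → ℝ :=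
  η ∘ anisotropicScaling ε

theorem contDiff_anisotropicCutoff (ε : ℝ) : ContDiff ℝ 2 (anisotropicCutoff η ε) :=
  (η.contDiff (n := (2 : ℕ∞))).comp (anisotropicScaling ε).contDiff

theorem hasCompactSupport_anisotropicCutoff {ε : ℝ} (hε : ε ≠ 0) :
    HasCompactSupport (anisotropicCutoff η ε) :=
  η.hasCompactSupport.comp_isClosedEmbedding (isClosedEmbedding_anisotropicScaling hε)

theorem eLpNorm_top_anisotropicCutoff_le_one (ε : ℝ) :
    eLpNorm (anisotropicCutoff η ε) ⊤ volume ≤ 1 := by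
  refine eLpNormEssSup_le_of_ae_enorm_bound (.of_forall fun x => ?_)
  rw [anisotropicCutoff, comp_apply, Real.enorm_of_nonneg η.nonneg]
  exact ENNReal.ofReal_le_one.2 η.le_one

theorem tendsto_anisotropicCutoff (x : R3) :
    Tendsto (fun ε => anisotropicCutoff η ε x) (𝓝[>] 0) (𝓝 1) := by
  have h := (η.continuous.tendsto 0).comp (tendsto_anisotropicScaling_zero x)
  rwa [η.eventuallyEq_one.eq_of_nhds] at h

theorem tendsto_eLpNorm_dirDeriv_anisotropicCutoff (i : Fin 3) {p : ℝ≥0∞}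
    (hp : 5 * (1 / p).toReal < scalingExponent i) :
    Tendsto (fun ε => eLpNorm (dirDeriv (stdBasis i) (anisotropicCutoff η ε)) p volume)
      (𝓝[>] 0) (𝓝 0) := by
  have hη : ContDiff ℝ 1 η := η.contDiff (n := (1 : ℕ∞))
  have hderiv (ε : ℝ) := dirDeriv_comp_of_apply_eq_smul (hη.differentiable one_ne_zero)
    (anisotropicScaling_stdBasis ε i)
  simpa only [anisotropicCutoff, hderiv] using tendsto_eLpNorm_pow_smul_comp_anisotropicScaling
    (continuous_dirDeriv hη _) (hasCompactSupport_dirDeriv η.hasCompactSupport _) hp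

theorem tendsto_eLpNorm_dirDeriv_dirDeriv_anisotropicCutoff (i j : Fin 3) :
    Tendsto (fun ε => eLpNorm (dirDeriv (stdBasis i) (dirDeriv (stdBasis j)
      (anisotropicCutoff η ε))) ⊤ volume) (𝓝[>] 0) (𝓝 0) := by
  have hη : ContDiff ℝ 2 η := η.contDiff (n := (2 : ℕ∞))
  have hηj : ContDiff ℝ 1 (dirDeriv (stdBasis j) η) :=
    contDiff_dirDeriv hη one_add_one_eq_two.le _
  have hderiv (ε : ℝ) :
      dirDeriv (stdBasis i) (dirDeriv (stdBasis j) (η ∘ anisotropicScaling ε)) =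
        ε ^ (scalingExponent j + scalingExponent i) •
          (dirDeriv (stdBasis i) (dirDeriv (stdBasis j) η) ∘ anisotropicScaling ε) := by
    have hdiff := hηj.differentiable one_ne_zero
    rw [dirDeriv_comp_of_apply_eq_smul (hη.differentiable two_ne_zero)
        (anisotropicScaling_stdBasis ε j),
      dirDeriv_const_smul (hdiff.comp (anisotropicScaling ε).differentiable),
      dirDeriv_comp_of_apply_eq_smul hdiff (anisotropicScaling_stdBasis ε i), smul_smul, pow_add]
  have hpos : 0 < scalingExponent j + scalingExponent i :=
    Nat.add_pos_left (scalingExponent_pos j) _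
  simpa only [anisotropicCutoff, hderiv] using tendsto_eLpNorm_pow_smul_comp_anisotropicScaling
    (p := ⊤) (continuous_dirDeriv hηj _)
    (hasCompactSupport_dirDeriv (hasCompactSupport_dirDeriv η.hasCompactSupport _) _)
    (by simpa using Nat.cast_pos.2 hpos)

theorem exists_anisotropic_cutoffs {q : ℝ≥0∞} (hq : 1 / q ≤ 1 / 2) :
    ∃ χ : ℕ → R3 → ℝ, (∀ n, ContDiff ℝ 2 (χ n)) ∧ (∀ n, HasCompactSupport (χ n)) ∧
      (∀ n, eLpNorm (χ n) ⊤ volume ≤ 1) ∧ (∀ x, Tendsto (fun n => χ n x) atTop (𝓝 1)) ∧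
      Tendsto (fun n => eLpNorm (dirDeriv (stdBasis 2) (χ n)) q volume) atTop (𝓝 0) ∧
      (∀ i, Tendsto (fun n => eLpNorm (dirDeriv (stdBasis i) (χ n)) ⊤ volume) atTop (𝓝 0)) ∧
      ∀ i j, Tendsto (fun n => eLpNorm (dirDeriv (stdBasis i) (dirDeriv (stdBasis j) (χ n))) ⊤
        volume) atTop (𝓝 0) := by
  obtain ⟨ε, hε₀, hε⟩ : ∃ ε : ℕ → ℝ, (∀ n, 0 < ε n) ∧ Tendsto ε atTop (𝓝[>] 0) :=
    ⟨fun n => 1 / (n + 1), fun n => Nat.one_div_pos_of_nat, tendsto_nhdsWithin_iff.2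
      ⟨tendsto_one_div_add_atTop_nhds_zero_nat,
        .of_forall fun _ => Set.mem_Ioi.2 Nat.one_div_pos_of_nat⟩⟩
  let η : ContDiffBump (0 : R3) := default
  have hq₂ : (1 / q).toReal ≤ 1 / 2 := by simpa using ENNReal.toReal_mono (by simp) hq
  have hq₃ : 5 * (1 / q).toReal < scalingExponent 2 := by
    have h₃ : scalingExponent 2 = 3 := rfl
    rw [h₃, Nat.cast_ofNat]
    linarith
  exact ⟨fun n => anisotropicCutoff η (ε n), fun n => contDiff_anisotropicCutoff η (ε n),
    fun n => hasCompactSupport_anisotropicCutoff η (hε₀ n).ne',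
    fun n => eLpNorm_top_anisotropicCutoff_le_one η (ε n),
    fun x => (tendsto_anisotropicCutoff η x).comp hε,
    (tendsto_eLpNorm_dirDeriv_anisotropicCutoff η 2 hq₃).comp hε,
    fun i => (tendsto_eLpNorm_dirDeriv_anisotropicCutoff η i
      (by simpa using scalingExponent_pos i)).comp hε,
    fun i j => (tendsto_eLpNorm_dirDeriv_dirDeriv_anisotropicCutoff η i j).comp hε⟩

end Cutoff

section Approximation

variable {f : Lp ℂ 2 (volume : Measure R3)} {φ χ : R3 → ℝ}

theorem eLpNorm_partialDeriv₂_le_hessian (f : Lp ℂ 2 (volume : Measure R3)) (i j : Fin 3) :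
    eLpNorm (partialDeriv₂ i j f) 2 volume ≤ eLpNorm (hessian f) 2 volume :=
  eLpNorm_mono fun x => PiLp.norm_apply_le (hessian f x) (i, j)

theorem memLp_hessian (f : Lp ℂ 2 (volume : Measure R3)) : MemLp (hessian f) 2 volume :=
  memLp_piLp_iff.2 fun _ => Lp.memLp _

theorem dirDeriv_dirDeriv_convolution (hf : MemH2 f) (hφ : ContDiff ℝ ∞ φ)
    (hφc : HasCompactSupport φ) (i j : Fin 3) :
    dirDeriv (stdBasis i) (dirDeriv (stdBasis j) (φ ⋆[ContinuousLinearMap.lsmul ℝ ℝ] f)) =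
      φ ⋆[ContinuousLinearMap.lsmul ℝ ℝ] (partialDeriv₂ i j f) := by
  rw [dirDeriv_convolution_Lp hφ hφc (coe_partialDeriv hf j),
    dirDeriv_convolution_Lp hφ hφc ((coe_partialDeriv₂ hf i j).trans
      (congrArg _ (coe_partialDeriv hf j).symm))]

/-- The function `f` mollified with `φ` and then cut off with `χ`. -/
noncomputable def regularize (φ χ : R3 → ℝ) (f : R3 → ℂ) : R3 → ℂ :=
  χ • (φ ⋆[ContinuousLinearMap.lsmul ℝ ℝ] f)

theorem contDiff_convolution (hφ : ContDiff ℝ ∞ φ) (hφc : HasCompactSupport φ)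
    (f : Lp ℂ 2 (volume : Measure R3)) :
    ContDiff ℝ 2 (φ ⋆[ContinuousLinearMap.lsmul ℝ ℝ] f) :=
  (hφc.contDiff_convolution_left _ hφ
    ((Lp.memLp f).locallyIntegrable one_le_two)).of_le (by norm_cast)

theorem eLpNorm_regularize_le (hφ : ContDiff ℝ ∞ φ) (hφc : HasCompactSupport φ)
    (hφ₁ : ∫⁻ x, ‖φ x‖ₑ ≤ 1) (hχ₁ : eLpNorm χ ⊤ volume ≤ 1)
    (f : Lp ℂ 2 (volume : Measure R3)) :
    eLpNorm (regularize φ χ f) 2 volume ≤ eLpNorm f 2 volume :=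
  (eLpNorm_smul_le_eLpNorm_top_mul_eLpNorm 2
    (contDiff_convolution hφ hφc f).continuous.aestronglyMeasurable χ).trans
    ((mul_le_mul' hχ₁ (eLpNorm_convolution_le hφ.continuous hφ₁ (Lp.aestronglyMeasurable f)
      one_le_two ENNReal.ofNat_ne_top)).trans_eq (one_mul _))

theorem eLpNorm_dirDeriv_regularize_le (hf : MemH2 f) (hφ : ContDiff ℝ ∞ φ)
    (hφc : HasCompactSupport φ) (hφ₁ : ∫⁻ x, ‖φ x‖ₑ ≤ 1) (hχ : ContDiff ℝ 1 χ)
    (hχ₁ : eLpNorm χ ⊤ volume ≤ 1) (i : Fin 3) {p q : ℝ≥0∞} [ENNReal.HolderTriple q 2 p]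
    (hp : 1 ≤ p) (hp' : p ≠ ⊤) :
    eLpNorm (dirDeriv (stdBasis i) (regularize φ χ f)) p volume ≤
      eLpNorm (dirDeriv (stdBasis i) χ) q volume * eLpNorm f 2 volume +
        eLpNorm (partialDeriv i f) p volume := by
  have hg := (contDiff_convolution hφ hφc f).of_le one_le_two
  have hmollify (h : Lp ℂ 2 (volume : Measure R3)) {r : ℝ≥0∞} (hr : 1 ≤ r) (hr' : r ≠ ⊤) :=
    eLpNorm_convolution_le hφ.continuous hφ₁ (Lp.aestronglyMeasurable h) hr hr'
  refine (eLpNorm_dirDeriv_smul_le hχ hg (stdBasis i) (p := 2) (q := q) hp).trans ?_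
  rw [dirDeriv_convolution_Lp hφ hφc (coe_partialDeriv hf i)]
  gcongr
  · exact hmollify f one_le_two ENNReal.ofNat_ne_top
  · exact (mul_le_mul' hχ₁ (hmollify _ hp hp')).trans_eq (one_mul _)

theorem hessianNorm_regularize_le (hf : MemH2 f) (hφ : ContDiff ℝ ∞ φ)
    (hφc : HasCompactSupport φ) (hφ₁ : ∫⁻ x, ‖φ x‖ₑ ≤ 1) (hχ : ContDiff ℝ 2 χ)
    (hχ₁ : eLpNorm χ ⊤ volume ≤ 1) :
    hessianNorm (regularize φ χ f) ≤ eLpNorm (hessian f) 2 volume + ∑ k : Fin 3 × Fin 3,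
      (eLpNorm (dirDeriv (stdBasis k.1) (dirDeriv (stdBasis k.2) χ)) ⊤ volume *
          eLpNorm f 2 volume +
        eLpNorm (dirDeriv (stdBasis k.2) χ) ⊤ volume * eLpNorm (partialDeriv k.1 f) 2 volume +
        eLpNorm (dirDeriv (stdBasis k.1) χ) ⊤ volume * eLpNorm (partialDeriv k.2 f) 2 volume) := by
  have hmollify (h : Lp ℂ 2 (volume : Measure R3)) :=
    eLpNorm_convolution_le hφ.continuous hφ₁ (Lp.aestronglyMeasurable h) one_le_two
      ENNReal.ofNat_ne_top
  refine iSup_le fun i => iSup_le fun j => ?_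
  refine (eLpNorm_dirDeriv_dirDeriv_smul_le hχ (contDiff_convolution hφ hφc f) _ _
    one_le_two).trans ?_
  rw [dirDeriv_dirDeriv_convolution hf hφ hφc, dirDeriv_convolution_Lp hφ hφc
    (coe_partialDeriv hf i), dirDeriv_convolution_Lp hφ hφc (coe_partialDeriv hf j), ← add_assoc,
    add_comm]
  refine add_le_add ?_ (le_trans ?_
    (Finset.single_le_sum_of_canonicallyOrdered (Finset.mem_univ (i, j))))
  · exact (mul_le_mul' hχ₁ (hmollify _)).trans
      ((one_mul _).trans_le (eLpNorm_partialDeriv₂_le_hessian f i j))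
  · dsimp only
    gcongr <;> exact hmollify _

theorem exists_holderTriple_two {p : ℝ≥0∞} (hp : 1 ≤ p) (hp₂ : p ≤ 2) :
    ∃ q : ℝ≥0∞, ENNReal.HolderTriple q 2 p ∧ 1 / q ≤ 1 / 2 := by
  have hsub : p⁻¹ - 2⁻¹ + 2⁻¹ = p⁻¹ := tsub_add_cancel_of_le (ENNReal.inv_le_inv.2 hp₂)
  refine ⟨(p⁻¹ - 2⁻¹)⁻¹, ⟨by rw [inv_inv, hsub]⟩, ?_⟩
  rw [one_div, inv_inv, one_div, tsub_le_iff_right, ENNReal.inv_two_add_inv_two]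
  exact ENNReal.inv_le_one.2 hp

theorem MemH2.exists_approximation (hf : MemH2 f) {p : ℝ≥0∞} (hp : 1 ≤ p) (hp₂ : p ≤ 2) :
    ∃ (u : ℕ → R3 → ℂ) (A H : ℕ → ℝ≥0∞), (∀ n, ContDiff ℝ 2 (u n)) ∧
      (∀ n, HasCompactSupport (u n)) ∧ (∀ᵐ x, Tendsto (fun n => u n x) atTop (𝓝 (f x))) ∧
      (∀ n, eLpNorm (u n) 2 volume ≤ eLpNorm f 2 volume) ∧
      (∀ n, eLpNorm (dirDeriv (stdBasis 2) (u n)) p volume ≤ A n) ∧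
      Tendsto A atTop (𝓝 (eLpNorm (partialDeriv 2 f) p volume)) ∧
      (∀ n, hessianNorm (u n) ≤ H n) ∧
      Tendsto H atTop (𝓝 (eLpNorm (hessian f) 2 volume)) := by
  obtain ⟨φ, hφ, hφc, hφ₁, hφlim⟩ := exists_mollifiers (F := ℂ) (volume : Measure R3)
  obtain ⟨q, hqp, hq⟩ := exists_holderTriple_two hp hp₂
  obtain ⟨χ, hχ, hχc, hχ₁, hχlim, hχ₃, hχi, hχij⟩ := exists_anisotropic_cutoffs hq
  have hzero {c : ℕ → ℝ≥0∞} (hc : Tendsto c atTop (𝓝 0)) (g : Lp ℂ 2 (volume : Measure R3)) :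
      Tendsto (fun n => c n * eLpNorm g 2 volume) atTop (𝓝 0) := by
    simpa using ENNReal.Tendsto.mul_const hc (.inr (Lp.eLpNorm_ne_top g))
  refine ⟨fun n => regularize (φ n) (χ n) f, _, _,
    fun n => (hχ n).smul (contDiff_convolution (hφ n) (hφc n) f),
    fun n => (hχc n).smul_right, ?_,
    fun n => eLpNorm_regularize_le (hφ n) (hφc n) (hφ₁ n).le (hχ₁ n) f,
    fun n => eLpNorm_dirDeriv_regularize_le hf (hφ n) (hφc n) (hφ₁ n).le
      ((hχ n).of_le one_le_two) (hχ₁ n) 2 (q := q) hp (hp₂.trans_lt ENNReal.ofNat_lt_top).ne, ?_,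
    fun n => hessianNorm_regularize_le hf (hφ n) (hφc n) (hφ₁ n).le (hχ n) (hχ₁ n), ?_⟩
  · filter_upwards [hφlim f ((Lp.memLp f).locallyIntegrable one_le_two)] with x hx
    rw [← one_smul ℝ (f x)]
    exact (hχlim x).smul hx
  · simpa using (hzero hχ₃ f).add_const (eLpNorm (partialDeriv 2 f) p volume)
  · simpa using (tendsto_finsetSum _ fun (k : Fin 3 × Fin 3) _ =>
      ((hzero (hχij k.1 k.2) f).add (hzero (hχi k.2) (partialDeriv k.1 f))).add
        (hzero (hχi k.1) (partialDeriv k.2 f))).const_add (eLpNorm (hessian f) 2 volume)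

theorem MemH2.eLpNorm_le_of_forall_contDiff (hf : MemH2 f) {p r : ℝ≥0∞} (hp : 1 ≤ p)
    (hp₂ : p ≤ 2) {Φ : ℝ≥0∞ × ℝ≥0∞ → ℝ≥0∞} (hΦ : Monotone Φ)
    (hΦc : ContinuousAt Φ (eLpNorm (partialDeriv 2 f) p volume, eLpNorm (hessian f) 2 volume))
    (h : ∀ u : R3 → ℂ, ContDiff ℝ 2 u → HasCompactSupport u →
      eLpNorm u 2 volume ≤ eLpNorm f 2 volume →
        eLpNorm u r volume ≤ Φ (eLpNorm (dirDeriv (stdBasis 2) u) p volume, hessianNorm u)) :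
    eLpNorm f r volume ≤
      Φ (eLpNorm (partialDeriv 2 f) p volume, eLpNorm (hessian f) 2 volume) := by
  obtain ⟨u, A, H, hu, huc, hlim, hu₂, huA, hA, huH, hH⟩ := hf.exists_approximation hp hp₂
  calc eLpNorm f r volume ≤ liminf (fun n => eLpNorm (u n) r volume) atTop :=
        Lp.eLpNorm_lim_le_liminf_eLpNorm (fun n => (hu n).continuous.aestronglyMeasurable) _ hlim
    _ ≤ liminf (fun n => Φ (A n, H n)) atTop := liminf_le_liminf <| .of_forall fun n =>
        (h _ (hu n) (huc n) (hu₂ n)).trans (hΦ ⟨huA n, huH n⟩)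
    _ = _ := (hΦc.tendsto.comp (hA.prodMk_nhds hH)).liminf_eq

theorem MemH2.eLpNorm_six_le (hf : MemH2 f) :
    eLpNorm f 6 volume ≤ 12 * (eLpNorm f 2 volume * eLpNorm (hessian f) 2 volume) ^ (1 / 2 : ℝ) :=
  hf.eLpNorm_le_of_forall_contDiff le_rfl one_le_two
    (Φ := fun x => 12 * (eLpNorm f 2 volume * x.2) ^ (1 / 2 : ℝ))
    (fun x y hxy => by dsimp only; gcongr; exact hxy.2) (by
        have hcont : Continuous fun x : ℝ≥0∞ × ℝ≥0∞ => eLpNorm f 2 volume * x.2 :=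
          (ENNReal.continuous_const_mul (Lp.eLpNorm_ne_top f)).comp continuous_snd
        exact ((ENNReal.continuous_const_mul ENNReal.ofNat_ne_top).comp
          (ENNReal.continuous_rpow_const.comp hcont)).continuousAt)
    fun u hu hc hu₂ => (eLpNorm_six_le_rpow_hessianNorm hu hc).trans (by gcongr)

theorem MemH2.eLpNorm_le_rpow_mul_rpow (hf : MemH2 f) {p r : ℝ≥0∞} (hp : 1 ≤ p)
    (hp₂ : p ≤ 2) {C : ℝ≥0} {s t : ℝ} (hs : 0 ≤ s) (ht : 0 ≤ t)
    (h : ∀ u : R3 → ℂ, ContDiff ℝ 2 u → HasCompactSupport u → eLpNorm u r volume ≤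
      C * eLpNorm (dirDeriv (stdBasis 2) u) p volume ^ s * hessianNorm u ^ t)
    (hA : eLpNorm (partialDeriv 2 f) p volume ≠ ⊤) :
    eLpNorm f r volume ≤
      C * eLpNorm (partialDeriv 2 f) p volume ^ s * eLpNorm (hessian f) 2 volume ^ t := by
  refine hf.eLpNorm_le_of_forall_contDiff hp hp₂ (Φ := fun x => C * x.1 ^ s * x.2 ^ t)
    (fun x y hxy => ?_) ?_ fun u hu hc _ => h u hu hc
  · dsimp only
    gcongr
    exacts [hxy.1, hxy.2]
  · have hA' := ENNReal.rpow_ne_top_of_nonneg hs hA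
    have hH' := ENNReal.rpow_ne_top_of_nonneg ht (memLp_hessian f).eLpNorm_ne_top
    exact ENNReal.Tendsto.mul (ENNReal.Tendsto.const_mul
      (ENNReal.continuous_rpow_const.comp continuous_fst).continuousAt (.inr ENNReal.coe_ne_top))
      (.inr hH') (ENNReal.continuous_rpow_const.comp continuous_snd).continuousAt
      (.inr (ENNReal.mul_ne_top ENNReal.coe_ne_top hA'))

theorem MemH2.ae_eq_zero_of_eLpNorm_hessian_eq_zero (hf : MemH2 f)
    (h : eLpNorm (hessian f) 2 volume = 0) : f =ᵐ[volume] 0 := by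
  have hsix := hf.eLpNorm_six_le
  rw [h, mul_zero, ENNReal.zero_rpow_of_pos (by norm_num), mul_zero] at hsix
  exact (eLpNorm_eq_zero_iff (Lp.aestronglyMeasurable f) (by norm_num)).1 (le_zero_iff.1 hsix)

end Approximation

theorem lemma2p2 (a b s : ℝ) (hs : 1 / 2 - 1 / b = s)
    (ha : 3 * (1 / a - 1 / 2) = 2 / s - 4) (hb : 2 < b) (ha₁ : 1 ≤ a) (ha₂ : a < 2) :
    ∃ C : ℝ≥0, 0 < C ∧ ∀ f : Lp ℂ 2 (volume : Measure R3), MemH2 f →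
      eLpNorm f (ENNReal.ofReal b) volume ≤
        C * eLpNorm (partialDeriv 2 f) (ENNReal.ofReal a) volume ^ s *
          eLpNorm (hessian f) 2 volume ^ (1 - s) := by
  have hs₀ : 0 < s := hs ▸ sub_pos.2 (one_div_lt_one_div_of_lt two_pos hb)
  have hs₁ : 0 ≤ 1 - s := by
    have : 0 < 1 / b := one_div_pos.2 (two_pos.trans hb)
    linarith
  obtain ⟨C, hC⟩ := exists_eLpNorm_le_rpow_mul_hessianNorm_rpow (F := ℂ) hs ha hb ha₁
  refine ⟨C + 1, by positivity, fun f hf => ?_⟩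
  by_cases hH : eLpNorm (hessian f) 2 volume = 0
  · simp [eLpNorm_congr_ae (hf.ae_eq_zero_of_eLpNorm_hessian_eq_zero hH)]
  by_cases hA : eLpNorm (partialDeriv 2 f) (ENNReal.ofReal a) volume = ⊤
  · simp [hA, hH, hs₀, ENNReal.mul_top, ENNReal.top_mul, (memLp_hessian f).eLpNorm_ne_top]
  · exact hf.eLpNorm_le_rpow_mul_rpow (by simpa using ENNReal.ofReal_le_ofReal ha₁)
      (by simpa using ENNReal.ofReal_le_ofReal ha₂.le) hs₀.le hs₁
      (fun u hu hc => (hC u hu hc).trans (by gcongr; exact le_self_add)) hA
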